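/- Let $n>2$ and let $\mathbb E^{m+1}_1$ denote $\mathbb R^{m+1}$ with the Lorentzian product $\langle x,y\rangle=-x_1y_1+x_2y_2+\dots+x_{m+1}y_{m+1}$. Put $$\mathcal{LC}^n=\{x\in\mathbb E^{n+1}_1:\langle x,x\rangle=0,\ x_1>0\},\qquad \mathcal{LC}^n\times\mathbb R\subset\mathbb E^{n+1}_1\times\mathbb R=\mathbb E^{n+2}_1,$$ and, for $0\ne a\in\mathbb E^{n+1}_1$ and $\tau>0$, $\Sigma(a,\tau)=\{x\in\mathcal{LC}^n:\langle x,a\rangle=\tau\}$. Let $M$ be a smooth $n$-dimensional non-degenerate (immersed) submanifold of $\mathbb E^{n+2}_1$ with position vector $\phi=(\phi_1,\dots,\phi_{n+2}):M\to\mathbb E^{n+2}_1$, lying on $\mathcal{LC}^n\times\mathbb R$. Then $\theta=(\phi_1,\dots,\phi_{n+1},0)$ is a light-like normal vector field of $M$; let $\alpha:M\to\mathbb R$ be the function defined by $\nabla^\perp_{(\partial_{x_{n+2}})^T}\theta=\alpha\,\theta$, where $(\cdot)^T$ is the tangential part and $\nabla^\perp$ the normal connection, and assume that $\alpha$ vanishes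 at no point of $M$. Let $h$ be the second fundamental form, $A_\zeta$ the shape operators ($\langle A_\zeta X,Y\rangle=\langle h(X,Y),\zeta\rangle$) and $H=\frac1n\operatorname{trace}h$ the mean curvature vector field. A submanifold is umbilical along a normal field $\zeta$ if $\langle A_\zeta X,Y\rangle=f\langle X,Y\rangle$ for a smooth function $f$ and all tangent $X,Y$; it is pseudo-umbilical if it is umbilical along $H$, and totally umbilical if it is umbilical along every smooth normal field. Then $M$ is pseudo-umbilical if and only if every point $p\in M$ has an open neighborhood in $M$ with smooth coordinates $(s,t)$, $t=(t_2,\dots,t_n)$, ranging over a product $I\times W$ of an open interval $I\subset\mathbb R$ and an open set $W\subset\mathbb R^{n-1}$, in which $$\phi(s,t)=(\hat\alpha(s)\gamma(t),\,s),$$ where - $\gamma:W\to\mathbb E^{n+1}_1$ is a smooth parametrization of a space-like (immersed) totally umbilical submanifold $\hat M^{n-1}$ of $\mathbb E^{n+1}_1$ contained in $\Sigma(a,\tau)$, for some $a\neq0$ with $\langle a,a\rangle=c\in\{1,-1,0\}$ and some $\tau>0$; - $\hat\alpha:I\to\mathbb R$ is smooth, nowhere zero, and satisfies on $I$ $$(n-2)\tau^2\,\hat\alpha\,\hat\alpha''-(n-1)\bigl(c+\tau^2(\hat\alpha')^2\bigr)=0.$$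 -/

import Mathlib

open scoped Manifold ContDiff

noncomputable section

namespace Minkowski

/-- The Minkowski space `E^{m+1}_1` is `ℝ^{m+1}` with the Lorentzian product
`⟨x, y⟩ = -x₁y₁ + x₂y₂ + ⋯ + x_{m+1}y_{m+1}`; the coordinate `x₁` has index `0`. -/
def mink {m : ℕ} (x y : Fin (m + 1) → ℝ) : ℝ :=
  -(x 0 * y 0) + ∑ i : Fin m, x i.succ * y i.succ

/-- The future component of the light cone, `LC^n ⊆ E^{n+1}_1`. -/
def lightCone (n : ℕ) : Set (Fin (n + 1) → ℝ) :=
  {x | mink x x = 0 ∧ 0 < x 0}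

/-- The light-like hypercylinder `LC^n × ℝ ⊆ E^{n+2}_1`:
`-x₁² + x₂² + ⋯ + x_{n+1}² = 0`, `x₁ > 0`, and `x_{n+2}` is arbitrary. -/
def lightCylinder (n : ℕ) : Set (Fin (n + 2) → ℝ) :=
  {x | (Fin.init x : Fin (n + 1) → ℝ) ∈ lightCone n}

/-- `Σ(a, τ) = {γ ∈ LC^n : ⟨γ, a⟩ = τ}`. -/
def sigmaSet {n : ℕ} (a : Fin (n + 1) → ℝ) (τ : ℝ) : Set (Fin (n + 1) → ℝ) :=
  {x | x ∈ lightCone n ∧ mink x a = τ}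

/-- The point `(v, s)` of `E^{n+2}_1 = E^{n+1}_1 × ℝ`. -/
def pairLast {n : ℕ} (v : Fin (n + 1) → ℝ) (s : ℝ) : Fin (n + 2) → ℝ :=
  Fin.snoc (α := fun _ => ℝ) v s

section Patch

/-! Pointwise extrinsic geometry of a parametrized submanifold
`F : ℝ^d → E^{m+1}_1`. Tangent vectors are written in coordinates: `X : ℝ^d` stands for
the tangent vector `DF(x) X`. -/

variable {d m : ℕ}

/-- The coordinate tangent vector `∂ᵢF` at `x`. -/
def coordVec (F : EuclideanSpace ℝ (Fin d) → (Fin (m + 1) → ℝ))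
    (x : EuclideanSpace ℝ (Fin d)) (i : Fin d) : Fin (m + 1) → ℝ :=
  fderiv ℝ F x (EuclideanSpace.single i 1)

/-- The induced metric `g(X, Y) = ⟨DF X, DF Y⟩` at `x`. -/
def inducedMetric (F : EuclideanSpace ℝ (Fin d) → (Fin (m + 1) → ℝ))
    (x X Y : EuclideanSpace ℝ (Fin d)) : ℝ :=
  mink (fderiv ℝ F x X) (fderiv ℝ F x Y)

/-- The matrix `(g_{ij})` of the induced metric. -/
def gram (F : EuclideanSpace ℝ (Fin d) → (Fin (m + 1) → ℝ))
    (x : EuclideanSpace ℝ (Fin d)) : Matrix (Fin d) (Fin d) ℝ :=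
  Matrix.of fun i j => mink (coordVec F x i) (coordVec F x j)

/-- The tangential part of `v`, in coordinates: `v^T = Σ_{i,j} g^{ij} ⟨v, ∂ⱼF⟩ ∂ᵢF`. -/
def tangentCoord (F : EuclideanSpace ℝ (Fin d) → (Fin (m + 1) → ℝ))
    (x : EuclideanSpace ℝ (Fin d)) (v : Fin (m + 1) → ℝ) : EuclideanSpace ℝ (Fin d) :=
  ∑ i, (∑ j, (gram F x)⁻¹ i j * mink v (coordVec F x j)) • EuclideanSpace.single i (1 : ℝ)

/-- The normal part `v^⊥ = v - v^T`. -/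
def normalPart (F : EuclideanSpace ℝ (Fin d) → (Fin (m + 1) → ℝ))
    (x : EuclideanSpace ℝ (Fin d)) (v : Fin (m + 1) → ℝ) : Fin (m + 1) → ℝ :=
  v - fderiv ℝ F x (tangentCoord F x v)

/-- The normal connection `∇^⊥_X ζ = (D_X ζ)^⊥` on a vector field `ζ` along `F`. -/
def normalDeriv (F ζ : EuclideanSpace ℝ (Fin d) → (Fin (m + 1) → ℝ))
    (x X : EuclideanSpace ℝ (Fin d)) : Fin (m + 1) → ℝ :=
  normalPart F x (fderiv ℝ ζ x X)

/-- The second fundamental form: `h(X, Y)` is the normal part of the ambient derivative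
`D_X (DF Y)` (`Y` extended with constant coordinates, which is no restriction because the
normal part is tensorial). -/
def secondForm (F : EuclideanSpace ℝ (Fin d) → (Fin (m + 1) → ℝ))
    (x X Y : EuclideanSpace ℝ (Fin d)) : Fin (m + 1) → ℝ :=
  normalPart F x (fderiv ℝ (fderiv ℝ F) x X Y)

/-- The mean curvature vector `H = (1/d) trace_g h = (1/d) Σ_{i,j} g^{ij} h(∂ᵢ, ∂ⱼ)`. -/
def meanCurvature (F : EuclideanSpace ℝ (Fin d) → (Fin (m + 1) → ℝ))
    (x : EuclideanSpace ℝ (Fin d)) : Fin (m + 1) → ℝ :=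
  (d : ℝ)⁻¹ • ∑ i, ∑ j, (gram F x)⁻¹ i j •
    secondForm F x (EuclideanSpace.single i 1) (EuclideanSpace.single j 1)

/-- `⟨A_ζ X, Y⟩`, where the shape operator `A_ζ` in the normal direction `ζ` is the
endomorphism of the tangent space determined by `⟨A_ζ X, Y⟩ = ⟨h(X, Y), ζ⟩`. -/
def shapeForm (F : EuclideanSpace ℝ (Fin d) → (Fin (m + 1) → ℝ))
    (x : EuclideanSpace ℝ (Fin d)) (ζ : Fin (m + 1) → ℝ)
    (X Y : EuclideanSpace ℝ (Fin d)) : ℝ :=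
  mink (secondForm F x X Y) ζ

/-- `F` parametrizes, over the open set `W`, a space-like (immersed) submanifold of
dimension `d`: it is smooth and the induced metric is positive definite (so `DF` is
injective). -/
structure IsSpacelikeOn (F : EuclideanSpace ℝ (Fin d) → (Fin (m + 1) → ℝ))
    (W : Set (EuclideanSpace ℝ (Fin d))) : Prop where
  smooth : ContDiffOn ℝ ∞ F W
  pos : ∀ x ∈ W, ∀ X, X ≠ 0 → 0 < inducedMetric F x X X

/-- The submanifold parametrized by `F` over the open set `W` is totally umbilical: it is
umbilical along every smooth normal vector field `ζ`. -/
def IsTotallyUmbilicalOn (F : EuclideanSpace ℝ (Fin d) → (Fin (m + 1) → ℝ))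
    (W : Set (EuclideanSpace ℝ (Fin d))) : Prop :=
  ∀ ζ : EuclideanSpace ℝ (Fin d) → (Fin (m + 1) → ℝ), ContDiffOn ℝ ∞ ζ W →
    (∀ x ∈ W, ∀ X, mink (ζ x) (fderiv ℝ F x X) = 0) →
    ∃ f : EuclideanSpace ℝ (Fin d) → ℝ, ContDiffOn ℝ ∞ f W ∧
      ∀ x ∈ W, ∀ X Y, shapeForm F x (ζ x) X Y = f x * inducedMetric F x X Y

end Patch

section Submanifold

/-! Submanifolds given by a map `φ : M → E^{m+1}_1` (the position vector) on a smooth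
`n`-manifold `M`. Everything at `p` is computed in the chart of `M` at `p`; tangent vectors
`X, Y : ℝ^n` at `p` are written in that chart, as in `TangentSpace (𝓡 n) p`. -/

variable {n m : ℕ} {M : Type*} [TopologicalSpace M]
  [ChartedSpace (EuclideanSpace ℝ (Fin n)) M]

/-- A map on `M` written in the chart at `p`. -/
def inChart (p : M) (φ : M → (Fin (m + 1) → ℝ)) :
    EuclideanSpace ℝ (Fin n) → (Fin (m + 1) → ℝ) :=
  fun x => φ ((extChartAt (𝓡 n) p).symm x)

/-- `φ` makes `M` a non-degenerate (immersed) submanifold of `E^{m+1}_1`: it is smooth and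
the induced metric is non-degenerate at every point (so the differential is injective). -/
structure IsNondegenerateSubmanifold (φ : M → (Fin (m + 1) → ℝ)) : Prop where
  smooth : ContMDiff (𝓡 n) 𝓘(ℝ, Fin (m + 1) → ℝ) ∞ φ
  nondegenerate : ∀ p : M, ∀ X : EuclideanSpace ℝ (Fin n),
    (∀ Y, inducedMetric (inChart p φ) (extChartAt (𝓡 n) p p) X Y = 0) → X = 0

/-- The mean curvature vector field of `M`. -/
def meanCurvatureField (φ : M → (Fin (m + 1) → ℝ)) (p : M) : Fin (m + 1) → ℝ :=
  meanCurvature (inChart p φ) (extChartAt (𝓡 n) p p)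

/-- `M` is umbilical along the normal field `ζ`: `⟨A_ζ X, Y⟩ = f ⟨X, Y⟩` for a smooth
function `f` on `M`. -/
def IsUmbilicalAlong (φ ζ : M → (Fin (m + 1) → ℝ)) : Prop :=
  ∃ f : M → ℝ, ContMDiff (𝓡 n) 𝓘(ℝ, ℝ) ∞ f ∧
    ∀ (p : M) (X Y : EuclideanSpace ℝ (Fin n)),
      shapeForm (inChart p φ) (extChartAt (𝓡 n) p p) (ζ p) X Y =
        f p * inducedMetric (inChart p φ) (extChartAt (𝓡 n) p p) X Y

/-- `M` is pseudo-umbilical: umbilical along its mean curvature vector field. -/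
def IsPseudoUmbilical (φ : M → (Fin (m + 1) → ℝ)) : Prop :=
  IsUmbilicalAlong (n := n) φ (meanCurvatureField (n := n) φ)

/-- The vector field `θ = (φ₁, …, φ_{n+1}, 0)` along `M`. -/
def thetaField (φ : M → (Fin (n + 2) → ℝ)) (p : M) : Fin (n + 2) → ℝ :=
  pairLast (Fin.init (φ p)) 0

/-- The constant vector `∂_{x_{n+2}}` of `E^{n+2}_1`. -/
def lastVec (n : ℕ) : Fin (n + 2) → ℝ :=
  pairLast 0 1

/-- `α` is the function on `M` defined by `∇^⊥_{(∂_{x_{n+2}})^T} θ = α θ`. -/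
def IsAlpha (φ : M → (Fin (n + 2) → ℝ)) (α : M → ℝ) : Prop :=
  ∀ p : M,
    normalDeriv (inChart p φ) (inChart p (thetaField φ)) (extChartAt (𝓡 n) p p)
      (tangentCoord (inChart p φ) (extChartAt (𝓡 n) p p) (lastVec n)) =
    α p • thetaField φ p

end Submanifold

end Minkowski

end

open Minkowski

open Minkowski
namespace Minkowski
open Filter Topology

/-! ### The Lorentzian product -/

section Product

variable {m n : ℕ}

/-! The normal bundle of `M` is a Lorentzian plane field spanned by the light-like `θ` and a second
light-like normal `ξ` with `⟨ξ, θ⟩ = -1`. Differentiating `⟨θ, θ⟩ = 0` twice gives `⟨h, θ⟩ = -(g -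
ds²)`, where `s` is the last coordinate, so only `⟨h, ξ⟩` is free. The gradient `T` of `s` is
`∂_{x_{n+2}}` plus a multiple of `θ`, hence a unit vector, and `ds²` has trace `1`. Thus `n H = (n -
1) ξ + t θ`, where `t` is the trace of `-⟨h, ξ⟩`, and pseudo-umbilicity at a point amounts to `⟨h,
ξ⟩ = -b ((n - 2) g + n ds²)` for some number `b` (`exists_umbilicalFrame`,
`UmbilicalFrame.shapeForm_eq`). This condition, `UmbilicalFrame`, is independent of coordinates.

Forward direction. Take as coordinates `s` and linear functions of the direction in the light cone.
Along `T` the direction is stationary, so `∂_s φ = T = ∂_{x_{n+2}} + z θ`. The mixed components of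
`⟨h, ξ⟩` vanish, which says that `z` depends on `s` only; integrating `∂_s log φ₁ = z` gives `φ =
(α̂(s) γ(t), s)` (`fderiv_logDerivFst`, `exists_warped`). In this form `UmbilicalFrame` says that
`γ` is umbilical, with factor `-k`, along its light-like normal `η` dual to `γ`, where `k` is an
expression in `α̂`, `α̂'`, `α̂''` (`UmbilicalFrame.coneFrame`). So `k` depends on `s` alone and on
`t` alone: it is constant. Then `u = η - k γ` is a constant vector with `⟨u, u⟩ = 2k` and `⟨γ, u⟩ =
-1` (`exists_constant_vector`). A multiple `a = -τ u` normalizes `⟨a, a⟩` to `1`, `-1` or `0`, and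
`k = c / (2 τ²)` is the differential equation (`warped_data`).

Converse. On `Σ(a, τ)` the vector `η = k γ - a / τ` with `k = ⟨a, a⟩ / (2 τ²)` is an umbilical
normal (`coneFrame_of_sigmaSet`). The differential equation turns it into an `UmbilicalFrame` for
`φ`, whose factor is an explicit smooth function of `s`. -/

lemma mink_comm (x y : Fin (m + 1) → ℝ) : mink x y = mink y x := by
  simp [mink, mul_comm]

lemma mink_add_left (x y z : Fin (m + 1) → ℝ) : mink (x + y) z = mink x z + mink y z := by
  simp only [mink, Pi.add_apply, add_mul, Finset.sum_add_distrib]; ring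

lemma mink_smul_left (r : ℝ) (x y : Fin (m + 1) → ℝ) : mink (r • x) y = r * mink x y := by
  simp only [mink, Pi.smul_apply, smul_eq_mul, mul_add, Finset.mul_sum, mul_assoc, mul_neg]

lemma mink_add_right (x y z : Fin (m + 1) → ℝ) : mink x (y + z) = mink x y + mink x z := by
  rw [mink_comm, mink_add_left, mink_comm y, mink_comm z]

lemma mink_smul_right (r : ℝ) (x y : Fin (m + 1) → ℝ) : mink x (r • y) = r * mink x y := by
  rw [mink_comm, mink_smul_left, mink_comm y]

lemma mink_neg_left (x y : Fin (m + 1) → ℝ) : mink (-x) y = -mink x y := by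
  simpa using mink_smul_left (-1) x y

lemma mink_neg_right (x y : Fin (m + 1) → ℝ) : mink x (-y) = -mink x y := by
  simpa using mink_smul_right (-1) x y

lemma mink_sub_left (x y z : Fin (m + 1) → ℝ) : mink (x - y) z = mink x z - mink y z := by
  rw [sub_eq_add_neg, mink_add_left, mink_neg_left, sub_eq_add_neg]

lemma mink_sub_right (x y z : Fin (m + 1) → ℝ) : mink x (y - z) = mink x y - mink x z := by
  rw [sub_eq_add_neg, mink_add_right, mink_neg_right, sub_eq_add_neg]

@[simp] lemma mink_zero_left (x : Fin (m + 1) → ℝ) : mink 0 x = 0 := by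
  simpa using mink_smul_left 0 x x

@[simp] lemma mink_zero_right (x : Fin (m + 1) → ℝ) : mink x 0 = 0 := by
  simpa using mink_smul_right 0 x x

lemma mink_sum_left {ι : Type*} (s : Finset ι) (f : ι → Fin (m + 1) → ℝ) (y : Fin (m + 1) → ℝ) :
    mink (∑ i ∈ s, f i) y = ∑ i ∈ s, mink (f i) y := by
  classical
  induction s using Finset.induction_on with
  | empty => simp
  | insert a s ha ih => rw [Finset.sum_insert ha, Finset.sum_insert ha, mink_add_left, ih]

lemma mink_sum_right {ι : Type*} (s : Finset ι) (f : ι → Fin (m + 1) → ℝ) (y : Fin (m + 1) → ℝ) :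
    mink y (∑ i ∈ s, f i) = ∑ i ∈ s, mink y (f i) := by
  simp only [mink_comm y, mink_sum_left]

lemma eq_zero_of_forall_mink {u : Fin (m + 1) → ℝ} (h : ∀ v, mink u v = 0) : u = 0 := by
  funext i
  refine Fin.cases ?_ (fun j => ?_) i
  · simpa [mink] using h (Pi.single 0 1)
  · have := h (Pi.single j.succ 1)
    simp only [mink, Pi.single_apply, Fin.succ_inj] at this
    simpa [(Fin.succ_ne_zero j).symm] using this

/-- The Lorentzian product as a continuous bilinear map. -/
noncomputable def minkCLM (m : ℕ) : (Fin (m + 1) → ℝ) →L[ℝ] (Fin (m + 1) → ℝ) →L[ℝ] ℝ :=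
  (LinearMap.mk₂ ℝ mink mink_add_left mink_smul_left mink_add_right
    mink_smul_right).toContinuousBilinearMap

@[simp] lemma minkCLM_apply (x y : Fin (m + 1) → ℝ) : minkCLM m x y = mink x y := rfl

lemma mink_pairLast (v w : Fin (n + 1) → ℝ) (s r : ℝ) :
    mink (pairLast v s) (pairLast w r) = mink v w + s * r := by
  simp only [mink, pairLast, Fin.sum_univ_castSucc (n := n)]
  have h0 : ∀ (v : Fin (n + 1) → ℝ) (s : ℝ),
      Fin.snoc (α := fun _ => ℝ) v s (0 : Fin (n + 2)) = v 0 := fun v s => by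
    rw [← Fin.castSucc_zero, Fin.snoc_castSucc]
  have h1 : ∀ (v : Fin (n + 1) → ℝ) (s : ℝ) (i : Fin n),
      Fin.snoc (α := fun _ => ℝ) v s (i.castSucc.succ : Fin (n + 2)) = v i.succ := fun v s i => by
    rw [← Fin.castSucc_succ, Fin.snoc_castSucc]
  have h2 : ∀ (v : Fin (n + 1) → ℝ) (s : ℝ),
      Fin.snoc (α := fun _ => ℝ) v s ((Fin.last n).succ : Fin (n + 2)) = s := fun v s => by
    rw [Fin.succ_last, Fin.snoc_last]
  simp only [h0, h1, h2]
  ring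

lemma pairLast_init_last (x : Fin (n + 2) → ℝ) :
    pairLast (Fin.init x) (x (Fin.last (n + 1))) = x := Fin.snoc_init_self x

@[simp] lemma init_pairLast (v : Fin (n + 1) → ℝ) (s : ℝ) :
    (Fin.init (pairLast v s) : Fin (n + 1) → ℝ) = v := Fin.init_snoc _ _

@[simp] lemma pairLast_last (v : Fin (n + 1) → ℝ) (s : ℝ) :
    pairLast v s (Fin.last (n + 1)) = s := Fin.snoc_last _ _

/-- `(v, s) ↦ pairLast v s` as a linear map. -/
noncomputable def pairLastCLM (n : ℕ) : ((Fin (n + 1) → ℝ) × ℝ) →L[ℝ] (Fin (n + 2) → ℝ) :=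
  LinearMap.toContinuousLinearMap
    { toFun := fun p => pairLast p.1 p.2
      map_add' := fun p q => by
        funext i
        refine Fin.lastCases ?_ (fun j => ?_) i <;> simp [pairLast]
      map_smul' := fun r p => by
        funext i
        refine Fin.lastCases ?_ (fun j => ?_) i <;> simp [pairLast] }

@[simp] lemma pairLastCLM_apply (p : (Fin (n + 1) → ℝ) × ℝ) :
    pairLastCLM n p = pairLast p.1 p.2 := rfl

/-- `Fin.init` as a linear map. -/
noncomputable def initCLM (n : ℕ) : (Fin (n + 2) → ℝ) →L[ℝ] (Fin (n + 1) → ℝ) :=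
  LinearMap.toContinuousLinearMap
    { toFun := fun x => Fin.init x
      map_add' := fun _ _ => rfl
      map_smul' := fun _ _ => rfl }

@[simp] lemma initCLM_apply (x : Fin (n + 2) → ℝ) : initCLM n x = Fin.init x := rfl

/-- The projection `(v, s) ↦ (v, 0)`. -/
noncomputable def dropLast (n : ℕ) : (Fin (n + 2) → ℝ) →L[ℝ] (Fin (n + 2) → ℝ) :=
  pairLastCLM n ∘L ContinuousLinearMap.inl ℝ (Fin (n + 1) → ℝ) ℝ ∘L initCLM n

lemma dropLast_apply (x : Fin (n + 2) → ℝ) : dropLast n x = pairLast (Fin.init x) 0 := rfl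

lemma mink_dropLast_right (x y : Fin (n + 2) → ℝ) :
    mink x (dropLast n y) = mink x y - x (Fin.last _) * y (Fin.last _) := by
  rw [dropLast_apply]
  nth_rw 1 2 [← pairLast_init_last x]
  nth_rw 2 [← pairLast_init_last y]
  rw [mink_pairLast, mink_pairLast]
  ring

lemma mink_lastVec (x : Fin (n + 2) → ℝ) : mink (lastVec n) x = x (Fin.last _) := by
  nth_rw 1 [← pairLast_init_last x]
  rw [lastVec, mink_pairLast]; simp

lemma dropLast_null {x : Fin (n + 2) → ℝ} (hx : x ∈ lightCylinder n) :
    mink (dropLast n x) (dropLast n x) = 0 := by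
  rw [dropLast_apply, mink_pairLast, hx.1]; simp

/-- A vector orthogonal to a vector of the light cone is space-like or proportional to it. -/
lemma mink_self_eq_zero_of_orthogonal {γ v : Fin (m + 1) → ℝ} (hγ : γ ∈ lightCone m)
    (h : mink v γ = 0) : 0 ≤ mink v v ∧ (mink v v = 0 → ∃ z : ℝ, v = z • γ) := by
  set w := v - (v 0 / γ 0) • γ with hw
  have hne : γ 0 ≠ 0 := hγ.2.ne'
  have hv : v = w + (v 0 / γ 0) • γ := by simp [hw]
  have hw0 : w 0 = 0 := by simp [hw, hne]
  have hww : mink v v = mink w w := by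
    have : mink w w = mink v v - 2 * (v 0 / γ 0) * mink v γ + (v 0 / γ 0) ^ 2 * mink γ γ := by
      rw [hw]
      simp only [mink_sub_left, mink_sub_right, mink_smul_left, mink_smul_right, mink_comm γ v]
      ring
    rw [this, h, hγ.1]; ring
  have hs : mink w w = ∑ i : Fin m, w i.succ * w i.succ := by simp [mink, hw0]
  rw [hww, hs]
  refine ⟨Finset.sum_nonneg fun i _ => mul_self_nonneg _, fun h0 => ⟨v 0 / γ 0, ?_⟩⟩
  have hz := (Finset.sum_eq_zero_iff_of_nonneg fun i _ => mul_self_nonneg _).1 h0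
  have : w = 0 := by
    funext i
    refine Fin.cases hw0 (fun j => ?_) i
    simpa using hz j (Finset.mem_univ _)
  rw [this] at hv; simpa using hv

/-- A non-degenerate subspace of codimension two and a hyperbolic pair in its orthogonal
complement span the whole space. -/
lemma exists_decomposition {E : Type*} [AddCommGroup E] [Module ℝ E]
    [FiniteDimensional ℝ E] {J : E →ₗ[ℝ] (Fin (m + 1) → ℝ)} (hd : Module.finrank ℝ E + 1 = m)
    (hJ : ∀ X, (∀ Y, mink (J X) (J Y) = 0) → X = 0) {θ ξ : Fin (m + 1) → ℝ}
    (hθ : ∀ X, mink θ (J X) = 0) (hξ : ∀ X, mink ξ (J X) = 0) (hθθ : mink θ θ = 0)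
    (hθξ : mink ξ θ = -1) (u : Fin (m + 1) → ℝ) :
    ∃ (X : E) (a b : ℝ), u = J X + (a • θ + b • ξ) := by
  let Φ : (E × ℝ × ℝ) →ₗ[ℝ] (Fin (m + 1) → ℝ) :=
    J.coprod ((LinearMap.toSpanSingleton ℝ _ θ).coprod (LinearMap.toSpanSingleton ℝ _ ξ))
  have hΦ : ∀ X a b, Φ (X, a, b) = J X + (a • θ + b • ξ) := fun X a b => by simp [Φ]
  have hinj : Function.Injective Φ := by
    rw [injective_iff_map_eq_zero]
    rintro ⟨X, a, b⟩ h
    rw [hΦ] at h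
    have hX : X = 0 := hJ X fun Y => by
      have := congrArg (fun v => mink v (J Y)) h
      simpa [mink_add_left, mink_smul_left, hθ, hξ] using this
    subst hX
    have hb : b = 0 := by
      have := congrArg (fun v => mink v θ) h
      simpa [mink_add_left, mink_smul_left, hθθ, hθξ] using this
    subst hb
    have ha : a = 0 := by
      have := congrArg (fun v => mink v ξ) h
      simpa [mink_add_left, mink_smul_left, mink_comm θ ξ, hθξ] using this
    subst ha
    rfl
  have hsurj : Function.Surjective Φ :=
    (LinearMap.injective_iff_surjective_of_finrank_eq_finrank (by simp; omega)).1 hinj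
  obtain ⟨⟨X, a, b⟩, h⟩ := hsurj u
  exact ⟨X, a, b, by rw [← h, hΦ]⟩

/-- A vector orthogonal to a non-degenerate subspace of codimension two and to a hyperbolic pair
in its orthogonal complement vanishes. -/
lemma eq_zero_of_orthogonal {E : Type*} [AddCommGroup E] [Module ℝ E]
    [FiniteDimensional ℝ E] {J : E →ₗ[ℝ] (Fin (m + 1) → ℝ)} (hd : Module.finrank ℝ E + 1 = m)
    (hJ : ∀ X, (∀ Y, mink (J X) (J Y) = 0) → X = 0) {θ ξ u : Fin (m + 1) → ℝ}
    (hθ : ∀ X, mink θ (J X) = 0) (hξ : ∀ X, mink ξ (J X) = 0) (hθθ : mink θ θ = 0)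
    (hθξ : mink ξ θ = -1) (hu : ∀ X, mink u (J X) = 0) (huθ : mink u θ = 0)
    (huξ : mink u ξ = 0) : u = 0 := by
  refine eq_zero_of_forall_mink fun v => ?_
  obtain ⟨X, a, b, rfl⟩ := exists_decomposition hd hJ hθ hξ hθθ hθξ v
  simp [mink_add_right, mink_smul_right, hu, huθ, huξ]

end Product

/-! ### Submanifolds of the light-like hypercylinder at a point -/

section Pointwise

variable {m n : ℕ} {E E' : Type*} [NormedAddCommGroup E] [NormedSpace ℝ E]
  [NormedAddCommGroup E'] [NormedSpace ℝ E']

/-- The metric induced by `F` is non-degenerate at `x`. -/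
def NondegenerateAt (F : E → (Fin (m + 1) → ℝ)) (x : E) : Prop :=
  ∀ X, (∀ Y, mink (fderiv ℝ F x X) (fderiv ℝ F x Y) = 0) → X = 0

/-- `ξ` is the light-like normal vector of `F` at `x` dual to the position vector of the light
cone, and the second fundamental form in the direction `ξ` is a multiple of
`(n - 2) g + n ds²`. -/
structure UmbilicalFrame (F : E → (Fin (n + 2) → ℝ)) (x : E) (ξ : Fin (n + 2) → ℝ) (b : ℝ) :
    Prop where
  normal : ∀ X, mink ξ (fderiv ℝ F x X) = 0
  null : mink ξ ξ = 0
  pairing : mink ξ (dropLast n (F x)) = -1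
  second : ∀ X Y, mink (fderiv ℝ (fderiv ℝ F) x X Y) ξ =
    -(b * (((n : ℝ) - 2) * mink (fderiv ℝ F x X) (fderiv ℝ F x Y)
      + n * (fderiv ℝ F x X (Fin.last _) * fderiv ℝ F x Y (Fin.last _))))

lemma hasFDerivAt_mink {f g : E → (Fin (m + 1) → ℝ)} {f' g' : E →L[ℝ] (Fin (m + 1) → ℝ)} {x : E}
    (hf : HasFDerivAt f f' x) (hg : HasFDerivAt g g' x) :
    HasFDerivAt (fun y => mink (f y) (g y))
      ((minkCLM m (f x)) ∘L g' + ((minkCLM m).flip (g x)) ∘L f') x := by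
  have := (minkCLM m).hasFDerivAt_of_bilinear hf hg
  refine this.congr_fderiv ?_
  ext X
  simp

lemma mink_fderiv_add {f g : E → (Fin (m + 1) → ℝ)} {x : E} {c : ℝ}
    (hf : DifferentiableAt ℝ f x) (hg : DifferentiableAt ℝ g x)
    (h : ∀ᶠ y in 𝓝 x, mink (f y) (g y) = c) (X : E) :
    mink (f x) (fderiv ℝ g x X) + mink (fderiv ℝ f x X) (g x) = 0 := by
  have h1 := (hasFDerivAt_mink hf.hasFDerivAt hg.hasFDerivAt).unique
    ((hasFDerivAt_const c x).congr_of_eventuallyEq h)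
  simpa using congrArg (fun L => L X) h1

/-- Differentiate `⟨θ, θ⟩ = 0`; as `θ` has last coordinate `0`, its product with `dθ X` equals its
product with `dF X`. -/
lemma theta_normal {F : E → (Fin (n + 2) → ℝ)} {x : E} (hF : DifferentiableAt ℝ F x)
    (hL : ∀ᶠ y in 𝓝 x, F y ∈ lightCylinder n) (X : E) :
    mink (dropLast n (F x)) (fderiv ℝ F x X) = 0 := by
  have hd : HasFDerivAt (fun y => dropLast n (F y)) (dropLast n ∘L fderiv ℝ F x) x :=
    (dropLast n).hasFDerivAt.comp x hF.hasFDerivAt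
  have h := mink_fderiv_add hd.differentiableAt hd.differentiableAt
    (hL.mono fun y hy => dropLast_null hy) X
  rw [hd.fderiv] at h
  simp only [ContinuousLinearMap.comp_apply] at h
  rw [mink_comm (dropLast n (fderiv ℝ F x X)), ← two_mul, mink_dropLast_right] at h
  simpa [dropLast_apply] using h

/-- Differentiate `⟨dF Y, θ⟩ = 0` along `X`. The derivative of `θ` is `dF X` without its last
coordinate, whence `g - ds²`. The shape operator along `θ` is therefore the same for every
submanifold of the hypercylinder. -/
lemma mink_second_theta {F : E → (Fin (n + 2) → ℝ)} {x : E} (hF : ContDiffAt ℝ 2 F x)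
    (hL : ∀ᶠ y in 𝓝 x, F y ∈ lightCylinder n) (X Y : E) :
    mink (fderiv ℝ (fderiv ℝ F) x X Y) (dropLast n (F x)) =
      -(mink (fderiv ℝ F x X) (fderiv ℝ F x Y)
        - fderiv ℝ F x X (Fin.last _) * fderiv ℝ F x Y (Fin.last _)) := by
  have hF1 : DifferentiableAt ℝ F x := hF.differentiableAt (by norm_num)
  have hF2 : DifferentiableAt ℝ (fderiv ℝ F) x :=
    (hF.fderiv_right (m := 1) (by norm_num)).differentiableAt (by norm_num)
  have hd : HasFDerivAt (fun y => dropLast n (F y)) (dropLast n ∘L fderiv ℝ F x) x :=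
    (dropLast n).hasFDerivAt.comp x hF1.hasFDerivAt
  have he : HasFDerivAt (fun y => fderiv ℝ F y Y)
      ((ContinuousLinearMap.apply ℝ _ Y) ∘L fderiv ℝ (fderiv ℝ F) x) x :=
    (ContinuousLinearMap.apply ℝ (Fin (n + 2) → ℝ) Y).hasFDerivAt.comp x hF2.hasFDerivAt
  have hev : ∀ᶠ y in 𝓝 x, mink (fderiv ℝ F y Y) (dropLast n (F y)) = 0 := by
    filter_upwards [hL.eventually_nhds, hF.eventually (by simp)] with y hy hFy
    rw [mink_comm]
    exact theta_normal (hFy.differentiableAt (by norm_num)) hy Y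
  have h := mink_fderiv_add he.differentiableAt hd.differentiableAt hev X
  rw [hd.fderiv, he.fderiv] at h
  simp only [ContinuousLinearMap.comp_apply, ContinuousLinearMap.apply_apply,
    mink_dropLast_right (fderiv ℝ F x Y)] at h
  rw [mink_comm (fderiv ℝ F x X)]
  linarith

/-- Second derivative of a composition. -/
lemma fderiv_fderiv_comp {V : Type*} [NormedAddCommGroup V] [NormedSpace ℝ V] {F : E → V}
    {G : E' → E} {x : E'} (hF : ContDiffAt ℝ 2 F (G x))
    (hG : ContDiffAt ℝ 2 G x) (X Y : E') :
    fderiv ℝ (fderiv ℝ (F ∘ G)) x X Y =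
      fderiv ℝ (fderiv ℝ F) (G x) (fderiv ℝ G x X) (fderiv ℝ G x Y)
        + fderiv ℝ F (G x) (fderiv ℝ (fderiv ℝ G) x X Y) := by
  have hF2 : DifferentiableAt ℝ (fderiv ℝ F) (G x) :=
    (hF.fderiv_right (m := 1) (by norm_num)).differentiableAt (by norm_num)
  have hG2 : DifferentiableAt ℝ (fderiv ℝ G) x :=
    (hG.fderiv_right (m := 1) (by norm_num)).differentiableAt (by norm_num)
  have hG1 : DifferentiableAt ℝ G x := hG.differentiableAt (by norm_num)
  have hev : fderiv ℝ (F ∘ G) =ᶠ[𝓝 x] fun y => (fderiv ℝ F (G y)) ∘L (fderiv ℝ G y) := by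
    filter_upwards [hG.continuousAt.eventually (hF.eventually (by simp)),
      hG.eventually (by simp)] with y hy hy'
    exact fderiv_comp y (hy.differentiableAt (by norm_num)) (hy'.differentiableAt (by norm_num))
  have h1 : HasFDerivAt (fun y => fderiv ℝ F (G y)) (fderiv ℝ (fderiv ℝ F) (G x) ∘L fderiv ℝ G x) x :=
    hF2.hasFDerivAt.comp x hG1.hasFDerivAt
  rw [hev.fderiv_eq, (h1.clm_comp hG2.hasFDerivAt).fderiv]
  simp [add_comm]

/-- The term that a coordinate change adds to the second derivative is tangential, and `ξ`
annihilates it. -/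
lemma UmbilicalFrame.comp {F : E → (Fin (n + 2) → ℝ)} {G : E' → E} {x : E'}
    {ξ : Fin (n + 2) → ℝ} {b : ℝ} (h : UmbilicalFrame F (G x) ξ b)
    (hF : ContDiffAt ℝ 2 F (G x)) (hG : ContDiffAt ℝ 2 G x) : UmbilicalFrame (F ∘ G) x ξ b := by
  have hd : fderiv ℝ (F ∘ G) x = (fderiv ℝ F (G x)) ∘L (fderiv ℝ G x) :=
    fderiv_comp x (hF.differentiableAt (by norm_num)) (hG.differentiableAt (by norm_num))
  refine ⟨fun X => by rw [hd]; exact h.normal _, h.null, h.pairing, fun X Y => ?_⟩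
  rw [fderiv_fderiv_comp hF hG, mink_add_left, mink_comm (fderiv ℝ F (G x) _), h.normal, add_zero,
    h.second, hd]
  rfl

lemma NondegenerateAt.comp {F : E → (Fin (m + 1) → ℝ)} {G : E' → E} {x : E'}
    (h : NondegenerateAt F (G x)) (hF : DifferentiableAt ℝ F (G x)) (hG : DifferentiableAt ℝ G x)
    (hbij : Function.Bijective (fderiv ℝ G x)) : NondegenerateAt (F ∘ G) x := by
  intro X hX
  rw [fderiv_comp x hF hG] at hX
  refine hbij.1 ?_
  rw [map_zero]
  refine h _ fun Y => ?_
  obtain ⟨Y, rfl⟩ := hbij.2 Y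
  exact hX Y

lemma UmbilicalFrame.congr {F F' : E → (Fin (n + 2) → ℝ)} {x : E} {ξ : Fin (n + 2) → ℝ} {b : ℝ}
    (h : UmbilicalFrame F x ξ b) (he : F' =ᶠ[𝓝 x] F) : UmbilicalFrame F' x ξ b := by
  have h1 : fderiv ℝ F' x = fderiv ℝ F x := he.fderiv_eq
  have h2 : fderiv ℝ (fderiv ℝ F') x = fderiv ℝ (fderiv ℝ F) x := he.fderiv.fderiv_eq
  refine ⟨fun X => by rw [h1]; exact h.normal _, h.null, by rw [he.eq_of_nhds]; exact h.pairing,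
    fun X Y => by rw [h1, h2]; exact h.second X Y⟩

lemma NondegenerateAt.congr {F F' : E → (Fin (m + 1) → ℝ)} {x : E}
    (h : NondegenerateAt F x) (he : F' =ᶠ[𝓝 x] F) : NondegenerateAt F' x := by
  intro X hX
  rw [he.fderiv_eq] at hX
  exact h X hX

end Pointwise

/-! ### Gram matrix and tangential part -/

section Gram

variable {n m : ℕ} {F : EuclideanSpace ℝ (Fin n) → (Fin (m + 1) → ℝ)}
  {x : EuclideanSpace ℝ (Fin n)}

lemma euclidean_eq_sum (X : EuclideanSpace ℝ (Fin n)) :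
    X = ∑ i, X i • EuclideanSpace.single i (1 : ℝ) := by
  ext j
  simp [Finset.sum_apply, Pi.single_apply]

lemma fderiv_eq_sum (X : EuclideanSpace ℝ (Fin n)) :
    fderiv ℝ F x X = ∑ i, X i • coordVec F x i := by
  conv_lhs => rw [euclidean_eq_sum X, map_sum]
  simp only [map_smul, coordVec]

lemma gram_symm (i j : Fin n) : gram F x i j = gram F x j i := mink_comm _ _

lemma gram_det_isUnit (h : NondegenerateAt F x) : IsUnit (gram F x).det := by
  rw [isUnit_iff_ne_zero]
  intro h0
  obtain ⟨v, hv, hv0⟩ := Matrix.exists_mulVec_eq_zero_iff.2 h0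
  refine hv ?_
  have : (WithLp.toLp 2 v : EuclideanSpace ℝ (Fin n)) = 0 := h _ fun Y => by
    rw [fderiv_eq_sum Y, mink_sum_right]
    refine Finset.sum_eq_zero fun j _ => ?_
    rw [mink_smul_right, fderiv_eq_sum, mink_sum_left]
    have := congrFun hv0 j
    simp only [Matrix.mulVec, dotProduct, Pi.zero_apply] at this
    have h2 : ∑ i, mink (v i • coordVec F x i) (coordVec F x j) = 0 := by
      rw [← this]
      refine Finset.sum_congr rfl fun i _ => ?_
      rw [mink_smul_left, gram_symm, mul_comm]; rfl
    simp only [h2, mul_zero]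
  funext i
  exact congrFun (congrArg (WithLp.ofLp) this) i

lemma fderiv_tangentCoord (v : Fin (m + 1) → ℝ) :
    fderiv ℝ F x (tangentCoord F x v) =
      ∑ i, (∑ j, (gram F x)⁻¹ i j * mink v (coordVec F x j)) • coordVec F x i := by
  simp only [tangentCoord, map_sum, map_smul, coordVec]

lemma mink_tangent (h : NondegenerateAt F x) (v : Fin (m + 1) → ℝ)
    (X : EuclideanSpace ℝ (Fin n)) :
    mink (fderiv ℝ F x (tangentCoord F x v)) (fderiv ℝ F x X) = mink v (fderiv ℝ F x X) := by
  have key : ∀ j, mink (fderiv ℝ F x (tangentCoord F x v)) (coordVec F x j) =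
      mink v (coordVec F x j) := by
    intro j
    have h1 : (gram F x * (gram F x)⁻¹) = 1 := Matrix.mul_nonsing_inv _ (gram_det_isUnit h)
    rw [fderiv_tangentCoord, mink_sum_left]
    calc _ = ∑ i, ∑ k, (gram F x j i * (gram F x)⁻¹ i k) * mink v (coordVec F x k) := by
          refine Finset.sum_congr rfl fun i _ => ?_
          rw [mink_smul_left, Finset.sum_mul]
          refine Finset.sum_congr rfl fun k _ => ?_
          rw [gram_symm j i]
          show _ * _ * gram F x i j = _
          ring
      _ = ∑ k, (gram F x * (gram F x)⁻¹) j k * mink v (coordVec F x k) := by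
          rw [Finset.sum_comm]
          simp only [Matrix.mul_apply, Finset.sum_mul]
      _ = _ := by
          rw [h1]; simp [Matrix.one_apply]
  rw [fderiv_eq_sum X, mink_sum_right, mink_sum_right]
  simp only [mink_smul_right, key]

lemma mink_normalPart_tangent (h : NondegenerateAt F x) (v : Fin (m + 1) → ℝ)
    (X : EuclideanSpace ℝ (Fin n)) : mink (normalPart F x v) (fderiv ℝ F x X) = 0 := by
  rw [normalPart, mink_sub_left, mink_tangent h, sub_self]

lemma mink_normalPart {ζ : Fin (m + 1) → ℝ} (hζ : ∀ X, mink ζ (fderiv ℝ F x X) = 0)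
    (v : Fin (m + 1) → ℝ) : mink (normalPart F x v) ζ = mink v ζ := by
  rw [normalPart, mink_sub_left, mink_comm (fderiv ℝ F x _), hζ, sub_zero]

lemma gram_trace (h : NondegenerateAt F x) :
    ∑ i, ∑ j, (gram F x)⁻¹ i j * mink (coordVec F x i) (coordVec F x j) = n := by
  have h1 : ((gram F x)⁻¹ * gram F x) = 1 := Matrix.nonsing_inv_mul _ (gram_det_isUnit h)
  calc _ = ∑ i, ((gram F x)⁻¹ * gram F x) i i := by
        simp only [Matrix.mul_apply]
        refine Finset.sum_congr rfl fun i _ => Finset.sum_congr rfl fun j _ => ?_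
        rw [gram_symm j i]; rfl
    _ = _ := by rw [h1]; simp

end Gram

/-! ### Pseudo-umbilicity in terms of the light-like normal frame -/

section Shape

variable {n : ℕ} {F : EuclideanSpace ℝ (Fin n) → (Fin (n + 2) → ℝ)}
  {x : EuclideanSpace ℝ (Fin n)}

lemma exists_null_normal (hF : DifferentiableAt ℝ F x)
    (hL : ∀ᶠ y in 𝓝 x, F y ∈ lightCylinder n) (hnd : NondegenerateAt F x) :
    ∃ ξ, (∀ X, mink ξ (fderiv ℝ F x X) = 0) ∧ mink ξ ξ = 0 ∧
      mink ξ (dropLast n (F x)) = -1 := by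
  have hθ := theta_normal hF hL
  have hx : F x ∈ lightCylinder n := hL.self_of_nhds
  have hθθ := dropLast_null hx
  set θ := dropLast n (F x) with hθdef
  have h0 : θ 0 ≠ 0 := by
    have : θ 0 = (Fin.init (F x) : Fin (n + 1) → ℝ) 0 := by
      rw [hθdef, dropLast_apply, pairLast, ← Fin.castSucc_zero, Fin.snoc_castSucc]
    rw [this]; exact hx.2.ne'
  set N : Fin (n + 2) → ℝ := (1 / θ 0) • normalPart F x (Pi.single 0 1) with hN
  have hNn : ∀ X, mink N (fderiv ℝ F x X) = 0 := fun X => by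
    rw [hN, mink_smul_left, mink_normalPart_tangent hnd, mul_zero]
  -- `⟨e₀, θ⟩ = -θ₀ ≠ 0` on the cone, so the normal part of `e₀` is transverse to `θ` and can be
  -- scaled to pair to `-1`.
  have hNθ : mink N θ = -1 := by
    rw [hN, mink_smul_left, mink_normalPart hθ]
    have : mink (Pi.single 0 1 : Fin (n + 2) → ℝ) θ = - θ 0 := by
      simp [mink]
    rw [this]; field_simp
  -- Adding a multiple of `θ` keeps the pairing with `θ`; this multiple makes the vector light-like.
  refine ⟨N + (mink N N / 2) • θ, fun X => ?_, ?_, ?_⟩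
  · rw [mink_add_left, hNn, mink_smul_left, hθ, mul_zero, add_zero]
  · simp only [mink_add_left, mink_add_right, mink_smul_left, mink_smul_right, hθθ, hNθ,
      mink_comm θ N]
    ring
  · rw [mink_add_left, hNθ, mink_smul_left, hθθ, mul_zero, add_zero]

/-- The gradient of the height function: `dF T` differs from `∂_{x_{n+2}}` by a multiple of the
light-like normal field. -/
lemma exists_height_gradient {E : Type*} [NormedAddCommGroup E] [NormedSpace ℝ E]
    [FiniteDimensional ℝ E] {F : E → (Fin (n + 2) → ℝ)} {x : E} {ξ : Fin (n + 2) → ℝ}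
    (hdim : Module.finrank ℝ E = n)
    (hF : DifferentiableAt ℝ F x) (hL : ∀ᶠ y in 𝓝 x, F y ∈ lightCylinder n)
    (hnd : NondegenerateAt F x) (hξ : ∀ X, mink ξ (fderiv ℝ F x X) = 0)
    (hξθ : mink ξ (dropLast n (F x)) = -1) :
    ∃ (T : E) (z : ℝ), fderiv ℝ F x T = lastVec n + z • dropLast n (F x) := by
  have hθ := theta_normal hF hL
  have hθθ := dropLast_null hL.self_of_nhds
  obtain ⟨T, a, b, h⟩ := exists_decomposition (J := (fderiv ℝ F x).toLinearMap)
    (by rw [hdim]) hnd hθ hξ hθθ hξθ (lastVec n)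
  -- Only `ξ` pairs non-trivially with `θ`, and `∂_{x_{n+2}}` is orthogonal to `θ`.
  have hb : b = 0 := by
    have h1 := congrArg (fun v => mink v (dropLast n (F x))) h
    simp only [mink_add_left, mink_smul_left, hθθ, hξθ, mink_lastVec,
      ContinuousLinearMap.coe_coe] at h1
    rw [mink_comm _ (dropLast n (F x)), hθ, dropLast_apply, pairLast_last] at h1
    linarith
  refine ⟨T, -a, ?_⟩
  rw [h, hb]
  simp

/-- The height function has unit gradient. -/
lemma mink_height_gradient {T : Fin (n + 2) → ℝ} {z : ℝ} {p : Fin (n + 2) → ℝ}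
    (h : T = lastVec n + z • dropLast n p) {v : Fin (n + 2) → ℝ}
    (hv : mink (dropLast n p) v = 0) : mink T v = v (Fin.last _) := by
  rw [h, mink_add_left, mink_lastVec, mink_smul_left, hv, mul_zero, add_zero]

lemma last_height_gradient {T : Fin (n + 2) → ℝ} {z : ℝ} {p : Fin (n + 2) → ℝ}
    (h : T = lastVec n + z • dropLast n p) : T (Fin.last _) = 1 := by
  rw [h, dropLast_apply, lastVec, Pi.add_apply, Pi.smul_apply, pairLast_last, pairLast_last]
  simp

/-- The trace of `ds²` is `ds` of the gradient of `s`, which is the last coordinate of `∂_{x_{n+2}}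
+ z θ`. -/
lemma height_trace {ξ : Fin (n + 2) → ℝ} (hF : DifferentiableAt ℝ F x)
    (hL : ∀ᶠ y in 𝓝 x, F y ∈ lightCylinder n)
    (hnd : NondegenerateAt F x) (hξ : ∀ X, mink ξ (fderiv ℝ F x X) = 0)
    (hξθ : mink ξ (dropLast n (F x)) = -1) :
    ∑ i, ∑ j, (gram F x)⁻¹ i j *
      (coordVec F x i (Fin.last _) * coordVec F x j (Fin.last _)) = 1 := by
  obtain ⟨T, z, hT⟩ := exists_height_gradient (by simp) hF hL hnd hξ hξθ
  have hTT : tangentCoord F x (lastVec n) = T := by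
    rw [← sub_eq_zero]
    refine hnd _ fun Y => ?_
    rw [map_sub, mink_sub_left, mink_tangent hnd, mink_lastVec,
      mink_height_gradient hT (theta_normal hF hL Y), sub_self]
  rw [← last_height_gradient hT, ← hTT, fderiv_tangentCoord]
  simp only [Finset.sum_apply, Pi.smul_apply, smul_eq_mul, mink_lastVec, Finset.sum_mul]
  exact Finset.sum_congr rfl fun i _ => Finset.sum_congr rfl fun j _ => by ring

/-- Both sides are normal and have the same products with `θ` and `ξ`. In a light-like frame the
coefficient of `ξ` is read off from the product with `θ`, and conversely. -/
lemma secondForm_eq {ξ : Fin (n + 2) → ℝ} (hF : ContDiffAt ℝ 2 F x)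
    (hL : ∀ᶠ y in 𝓝 x, F y ∈ lightCylinder n)
    (hnd : NondegenerateAt F x) (hξ : ∀ X, mink ξ (fderiv ℝ F x X) = 0) (hξξ : mink ξ ξ = 0)
    (hξθ : mink ξ (dropLast n (F x)) = -1) (X Y : EuclideanSpace ℝ (Fin n)) :
    secondForm F x X Y =
      (mink (fderiv ℝ F x X) (fderiv ℝ F x Y)
        - fderiv ℝ F x X (Fin.last _) * fderiv ℝ F x Y (Fin.last _)) • ξ
      + (-mink (fderiv ℝ (fderiv ℝ F) x X Y) ξ) • dropLast n (F x) := by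
  have hθ := theta_normal (hF.differentiableAt (by norm_num)) hL
  have hθθ := dropLast_null hL.self_of_nhds
  have hh := mink_second_theta hF hL X Y
  rw [← sub_eq_zero]
  refine eq_zero_of_orthogonal (J := (fderiv ℝ F x).toLinearMap) (by simp) hnd hθ hξ hθθ hξθ
    (fun Z => ?_) ?_ ?_
  · simp only [mink_sub_left, mink_add_left, mink_smul_left, ContinuousLinearMap.coe_coe, hθ, hξ,
      secondForm, mink_normalPart_tangent hnd]
    ring
  · simp only [mink_sub_left, mink_add_left, mink_smul_left, secondForm, mink_normalPart hθ, hθθ,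
      hξθ, hh]
    ring
  · simp only [mink_sub_left, mink_add_left, mink_smul_left, secondForm, mink_normalPart hξ, hξξ,
      mink_comm (dropLast n (F x)) ξ, hξθ]
    ring

/-- The trace of the second fundamental form in the direction `-ξ`. -/
noncomputable def normalTrace (F : EuclideanSpace ℝ (Fin n) → (Fin (n + 2) → ℝ))
    (x : EuclideanSpace ℝ (Fin n)) (ξ : Fin (n + 2) → ℝ) : ℝ :=
  ∑ i, ∑ j, (gram F x)⁻¹ i j * -mink (fderiv ℝ (fderiv ℝ F) x (EuclideanSpace.single i 1)
    (EuclideanSpace.single j 1)) ξ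

lemma mul_shapeForm_meanCurvature {ξ : Fin (n + 2) → ℝ} (hn : n ≠ 0) (hF : ContDiffAt ℝ 2 F x)
    (hL : ∀ᶠ y in 𝓝 x, F y ∈ lightCylinder n)
    (hnd : NondegenerateAt F x) (hξ : ∀ X, mink ξ (fderiv ℝ F x X) = 0) (hξξ : mink ξ ξ = 0)
    (hξθ : mink ξ (dropLast n (F x)) = -1) (X Y : EuclideanSpace ℝ (Fin n)) :
    n * shapeForm F x (meanCurvature F x) X Y =
      -(normalTrace F x ξ * (mink (fderiv ℝ F x X) (fderiv ℝ F x Y)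
        - fderiv ℝ F x X (Fin.last _) * fderiv ℝ F x Y (Fin.last _)))
      + (n - 1) * mink (fderiv ℝ (fderiv ℝ F) x X Y) ξ := by
  have hθθ := dropLast_null hL.self_of_nhds
  have hn' : (n : ℝ) ≠ 0 := by exact_mod_cast hn
  -- The coefficient `n - 1` is the trace of `g - ds²`.
  have hH : (n : ℝ) • meanCurvature F x =
      ((n : ℝ) - 1) • ξ + normalTrace F x ξ • dropLast n (F x) := by
    rw [meanCurvature, smul_smul, mul_inv_cancel₀ hn', one_smul]
    simp only [secondForm_eq hF hL hnd hξ hξξ hξθ, smul_add, Finset.sum_add_distrib, smul_smul,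
      ← Finset.sum_smul]
    congr 2
    simp only [mul_sub, Finset.sum_sub_distrib]
    exact congrArg₂ _ (gram_trace hnd)
      (height_trace (hF.differentiableAt (by norm_num)) hL hnd hξ hξθ)
  rw [shapeForm, ← mink_smul_right, hH, secondForm_eq hF hL hnd hξ hξξ hξθ]
  simp only [mink_add_left, mink_add_right, mink_smul_left, mink_smul_right, hξξ, hθθ, hξθ,
    mink_comm (dropLast n (F x)) ξ]
  ring

lemma normalTrace_eq {ξ : Fin (n + 2) → ℝ} (hF : DifferentiableAt ℝ F x)
    (hL : ∀ᶠ y in 𝓝 x, F y ∈ lightCylinder n)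
    (hnd : NondegenerateAt F x) (hξ : ∀ X, mink ξ (fderiv ℝ F x X) = 0)
    (hξθ : mink ξ (dropLast n (F x)) = -1) {u v : ℝ}
    (h : ∀ X Y, mink (fderiv ℝ (fderiv ℝ F) x X Y) ξ =
      -(u * mink (fderiv ℝ F x X) (fderiv ℝ F x Y)
      + v * (fderiv ℝ F x X (Fin.last _) * fderiv ℝ F x Y (Fin.last _)))) :
    normalTrace F x ξ = u * n + v := by
  have h1 := gram_trace hnd
  have h2 := height_trace hF hL hnd hξ hξθ
  simp only [normalTrace, h, neg_neg, mul_add, Finset.sum_add_distrib, mul_left_comm _ u,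
    mul_left_comm _ v, ← Finset.mul_sum]
  exact congrArg₂ _ (congrArg _ h1) ((congrArg (v * ·) h2).trans (mul_one v))

/-- The weights `n - 2` and `n` give trace `b n (n - 1)`, exactly what makes the two `ds²` terms of
`mul_shapeForm_meanCurvature` cancel. -/
lemma UmbilicalFrame.shapeForm_eq {ξ : Fin (n + 2) → ℝ} {b : ℝ} (hn : 2 < n)
    (hF : ContDiffAt ℝ 2 F x) (hL : ∀ᶠ y in 𝓝 x, F y ∈ lightCylinder n)
    (hnd : NondegenerateAt F x) (h : UmbilicalFrame F x ξ b) (X Y : EuclideanSpace ℝ (Fin n)) :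
    shapeForm F x (meanCurvature F x) X Y =
      -(((n : ℝ) - 1) * (2 * n - 2) * b / n) * inducedMetric F x X Y := by
  have hn' : (n : ℝ) ≠ 0 := by positivity
  have hs := mul_shapeForm_meanCurvature (by omega) hF hL hnd h.normal h.null h.pairing X Y
  have ht : normalTrace F x ξ = b * (n - 2) * n + b * n :=
    normalTrace_eq (hF.differentiableAt (by norm_num)) hL hnd h.normal h.pairing
      fun X Y => by rw [h.second]; ring
  rw [ht, h.second] at hs
  rw [inducedMetric]
  field_simp
  linear_combination hs

lemma exists_umbilicalFrame (hn : 2 < n) (hF : ContDiffAt ℝ 2 F x)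
    (hL : ∀ᶠ y in 𝓝 x, F y ∈ lightCylinder n) (hnd : NondegenerateAt F x) {f : ℝ}
    (h : ∀ X Y, shapeForm F x (meanCurvature F x) X Y = f * inducedMetric F x X Y) :
    ∃ ξ b, UmbilicalFrame F x ξ b := by
  have hF1 : DifferentiableAt ℝ F x := hF.differentiableAt (by norm_num)
  obtain ⟨ξ, hξ, hξξ, hξθ⟩ := exists_null_normal hF1 hL hnd
  have hn2 : (2 : ℝ) < n := by exact_mod_cast hn
  have hn0 : (n : ℝ) ≠ 0 := by positivity
  have hn1 : (n : ℝ) - 1 ≠ 0 := by linarith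
  set t := normalTrace F x ξ with ht
  -- Solving the umbilicity equation for `⟨h, ξ⟩` still leaves the two unknowns `f` and `t`; taking
  -- the trace of the result relates them and leaves a single parameter `b`.
  have hs : ∀ X Y, mink (fderiv ℝ (fderiv ℝ F) x X Y) ξ =
      -((-(n * f + t) / (n - 1)) * mink (fderiv ℝ F x X) (fderiv ℝ F x Y)
      + (t / (n - 1)) * (fderiv ℝ F x X (Fin.last _) * fderiv ℝ F x Y (Fin.last _))) := by
    intro X Y
    have := mul_shapeForm_meanCurvature (by omega) hF hL hnd hξ hξξ hξθ X Y
    rw [h, inducedMetric, ← ht] at this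
    field_simp
    linear_combination -this
  have htr := normalTrace_eq hF1 hL hnd hξ hξθ hs
  rw [← ht] at htr
  refine ⟨ξ, t / (n * (n - 1)), hξ, hξξ, hξθ, fun X Y => ?_⟩
  have hf : n * f = -t * (2 * n - 2) / n := by
    field_simp at htr ⊢
    linear_combination htr
  rw [hs, hf]
  field_simp
  ring

end Shape

/-! ### Maps of the form `(s, t) ↦ (α(s) γ(t), s)` -/

section Warped

variable {n : ℕ} {V : Type*} [NormedAddCommGroup V] [NormedSpace ℝ V]

lemma hasFDerivAt_fderiv_apply {E W : Type*} [NormedAddCommGroup E] [NormedSpace ℝ E]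
    [NormedAddCommGroup W] [NormedSpace ℝ W] {F : E → W} {x : E} (hF : ContDiffAt ℝ 2 F x) (Y : E) :
    HasFDerivAt (fun y => fderiv ℝ F y Y)
      ((ContinuousLinearMap.apply ℝ W Y) ∘L fderiv ℝ (fderiv ℝ F) x) x :=
  (ContinuousLinearMap.apply ℝ W Y).hasFDerivAt.comp x
    ((hF.fderiv_right (m := 1) (by norm_num)).differentiableAt (by norm_num)).hasFDerivAt

lemma fderiv_fderiv_apply {E W : Type*} [NormedAddCommGroup E] [NormedSpace ℝ E]
    [NormedAddCommGroup W] [NormedSpace ℝ W] {F : E → W} {x : E} (hF : ContDiffAt ℝ 2 F x)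
    (X Y : E) : fderiv ℝ (fderiv ℝ F) x X Y = fderiv ℝ (fun y => fderiv ℝ F y Y) x X := by
  rw [(hasFDerivAt_fderiv_apply hF Y).fderiv]; rfl

/-- The map `(s, t) ↦ (α(s) γ(t), s)`. -/
noncomputable def warped (α : ℝ → ℝ) (γ : V → (Fin (n + 1) → ℝ)) (y : ℝ × V) : Fin (n + 2) → ℝ :=
  pairLast (α y.1 • γ y.2) y.1

variable {α : ℝ → ℝ} {γ : V → (Fin (n + 1) → ℝ)} {s : ℝ} {t : V}

lemma contDiffAt_warped {k : WithTop ℕ∞} (hα : ContDiffAt ℝ k α s) (hγ : ContDiffAt ℝ k γ t) :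
    ContDiffAt ℝ k (warped α γ) (s, t) := by
  have h1 : ContDiffAt ℝ k (fun y : ℝ × V => α y.1) (s, t) := hα.comp (s, t) contDiffAt_fst
  have h2 : ContDiffAt ℝ k (fun y : ℝ × V => γ y.2) (s, t) := hγ.comp (s, t) contDiffAt_snd
  exact (pairLastCLM n).contDiff.contDiffAt.comp (s, t) ((h1.smul h2).prodMk contDiffAt_fst)

lemma hasFDerivAt_smul_prod {E W : Type*} [NormedAddCommGroup E] [NormedSpace ℝ E]
    [NormedAddCommGroup W] [NormedSpace ℝ W] {f : ℝ → ℝ} {g : E → W} {s f' : ℝ} {t : E}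
    {g' : E →L[ℝ] W} (hf : HasDerivAt f f' s) (hg : HasFDerivAt g g' t) :
    HasFDerivAt (fun y : ℝ × E => f y.1 • g y.2)
      (f s • (g' ∘L ContinuousLinearMap.snd ℝ ℝ E)
        + (f' • ContinuousLinearMap.fst ℝ ℝ E).smulRight (g t)) (s, t) := by
  have h1 : HasFDerivAt (fun y : ℝ × E => f y.1) (f' • ContinuousLinearMap.fst ℝ ℝ E) (s, t) :=
    HasDerivAt.comp_hasFDerivAt (s, t) hf hasFDerivAt_fst
  have h2 : HasFDerivAt (fun y : ℝ × E => g y.2) (g' ∘L ContinuousLinearMap.snd ℝ ℝ E) (s, t) :=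
    HasFDerivAt.comp (s, t) hg hasFDerivAt_snd
  exact h1.smul h2

lemma fderiv_warped (hα : DifferentiableAt ℝ α s) (hγ : DifferentiableAt ℝ γ t) (X : ℝ × V) :
    fderiv ℝ (warped α γ) (s, t) X =
      pairLast ((X.1 * deriv α s) • γ t + α s • fderiv ℝ γ t X.2) X.1 := by
  have h := (pairLastCLM n).hasFDerivAt.comp (s, t)
    ((hasFDerivAt_smul_prod hα.hasDerivAt hγ.hasFDerivAt).prodMk hasFDerivAt_fst)
  have h' : HasFDerivAt (warped α γ) _ (s, t) := h
  rw [h'.fderiv]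
  simp [add_comm, mul_comm]

lemma fderiv_fderiv_warped (hα : ContDiffAt ℝ 2 α s) (hγ : ContDiffAt ℝ 2 γ t) (X Y : ℝ × V) :
    fderiv ℝ (fderiv ℝ (warped α γ)) (s, t) X Y =
      pairLast ((X.1 * Y.1 * deriv (deriv α) s) • γ t
        + deriv α s • (Y.1 • fderiv ℝ γ t X.2 + X.1 • fderiv ℝ γ t Y.2)
        + α s • fderiv ℝ (fderiv ℝ γ) t X.2 Y.2) 0 := by
  rw [fderiv_fderiv_apply (contDiffAt_warped hα hγ)]
  have hev : (fun y => fderiv ℝ (warped α γ) y Y) =ᶠ[𝓝 (s, t)]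
      fun y => pairLast ((Y.1 * deriv α y.1) • γ y.2 + α y.1 • fderiv ℝ γ y.2 Y.2) Y.1 := by
    have h1 := (continuous_fst.tendsto (s, t)).eventually (hα.eventually (by simp))
    have h2 := (continuous_snd.tendsto (s, t)).eventually (hγ.eventually (by simp))
    filter_upwards [h1, h2] with y hy1 hy2
    exact fderiv_warped (hy1.differentiableAt (by norm_num)) (hy2.differentiableAt (by norm_num)) Y
  have hα1 : DifferentiableAt ℝ (deriv α) s :=
    (hα.derivWithin (m := 1) (by norm_num)).differentiableAt (by norm_num)
  have h1 := hasFDerivAt_smul_prod (hα1.hasDerivAt.const_mul Y.1)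
    (hγ.differentiableAt (by norm_num)).hasFDerivAt
  have h2 := hasFDerivAt_smul_prod (hα.differentiableAt (by norm_num)).hasDerivAt
    (hasFDerivAt_fderiv_apply hγ Y.2)
  have h : HasFDerivAt (fun y : ℝ × V =>
      pairLast ((Y.1 * deriv α y.1) • γ y.2 + α y.1 • fderiv ℝ γ y.2 Y.2) Y.1) _ (s, t) :=
    (pairLastCLM n).hasFDerivAt.comp (s, t) ((h1.add h2).prodMk (hasFDerivAt_const Y.1 _))
  rw [hev.fderiv_eq, h.fderiv]
  simp only [ContinuousLinearMap.comp_apply, ContinuousLinearMap.prod_apply,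
    add_apply, smul_apply,
    ContinuousLinearMap.smulRight_apply, ContinuousLinearMap.coe_snd', ContinuousLinearMap.coe_fst',
    zero_apply, ContinuousLinearMap.apply_apply, pairLastCLM_apply,
    smul_eq_mul]
  congr 1
  module

end Warped

/-! ### Submanifolds of the light cone -/

section Cone

variable {m n : ℕ} {V : Type*} [NormedAddCommGroup V] [NormedSpace ℝ V]

/-- `η` is the light-like normal vector of `γ` at `t` dual to `γ t`, and `γ` is umbilical in its
direction with factor `-k`. -/
structure ConeFrame (γ : V → (Fin (m + 1) → ℝ)) (t : V) (η : Fin (m + 1) → ℝ) (k : ℝ) : Prop where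
  normal : ∀ v, mink η (fderiv ℝ γ t v) = 0
  null : mink η η = 0
  pairing : mink η (γ t) = -1
  second : ∀ v w, mink (fderiv ℝ (fderiv ℝ γ) t v w) η =
    -(k * mink (fderiv ℝ γ t v) (fderiv ℝ γ t w))

section

variable {γ : V → (Fin (m + 1) → ℝ)} {t : V}

lemma cone_normal (hγ : DifferentiableAt ℝ γ t)
    (hL : ∀ᶠ y in 𝓝 t, γ y ∈ lightCone m) (v : V) : mink (γ t) (fderiv ℝ γ t v) = 0 := by
  have h := mink_fderiv_add hγ hγ (hL.mono fun y hy => hy.1) v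
  rw [mink_comm (fderiv ℝ γ t v), ← two_mul] at h
  simpa using h

lemma mink_second_add {c : ℝ} {g : V → (Fin (m + 1) → ℝ)} (hγ : ContDiffAt ℝ 2 γ t)
    (hg : DifferentiableAt ℝ g t) {w : V}
    (h : ∀ᶠ y in 𝓝 t, mink (g y) (fderiv ℝ γ y w) = c) (v : V) :
    mink (fderiv ℝ (fderiv ℝ γ) t v w) (g t) + mink (fderiv ℝ g t v) (fderiv ℝ γ t w) = 0 := by
  have h1 := mink_fderiv_add hg (hasFDerivAt_fderiv_apply hγ w).differentiableAt h v
  rw [← fderiv_fderiv_apply hγ, mink_comm (g t)] at h1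
  exact h1

lemma cone_second (hγ : ContDiffAt ℝ 2 γ t)
    (hL : ∀ᶠ y in 𝓝 t, γ y ∈ lightCone m) (v w : V) :
    mink (fderiv ℝ (fderiv ℝ γ) t v w) (γ t) = -mink (fderiv ℝ γ t v) (fderiv ℝ γ t w) := by
  have hev : ∀ᶠ y in 𝓝 t, mink (γ y) (fderiv ℝ γ y w) = 0 := by
    filter_upwards [hL.eventually_nhds, hγ.eventually (by simp)] with y hy hy'
    exact cone_normal (hy'.differentiableAt (by norm_num)) hy w
  have := mink_second_add hγ (hγ.differentiableAt (by norm_num)) hev v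
  linarith

end

variable {α : ℝ → ℝ} {γ : V → (Fin (n + 1) → ℝ)} {s : ℝ} {t : V}

lemma dropLast_pairLast (v : Fin (n + 1) → ℝ) (r : ℝ) :
    dropLast n (pairLast v r) = pairLast v 0 := by
  rw [dropLast_apply, init_pairLast]

/-- The umbilicity factor of `γ` determined by the warping function. -/
noncomputable def warpFactor (n : ℕ) (α : ℝ → ℝ) (s : ℝ) : ℝ :=
  (n - 2) / (2 * (n - 1)) * α s * deriv (deriv α) s - deriv α s ^ 2 / 2

lemma ConeFrame.umbilicalFrame_warped {η : Fin (n + 1) → ℝ} {k : ℝ} (hn : 2 < n)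
    (h : ConeFrame γ t η k) (hα : ContDiffAt ℝ 2 α s) (hγ : ContDiffAt ℝ 2 γ t) (hα0 : α s ≠ 0)
    (hL : ∀ᶠ y in 𝓝 t, γ y ∈ lightCone n) (hk : k = warpFactor n α s) :
    ∃ ξ, UmbilicalFrame (warped α γ) (s, t) ξ (deriv (deriv α) s / (α s * (2 * n - 2))) := by
  have hα1 := hα.differentiableAt (by norm_num)
  have hγ1 := hγ.differentiableAt (by norm_num)
  have hγγ : mink (γ t) (γ t) = 0 := hL.self_of_nhds.1
  have hγn := cone_normal hγ1 hL
  have hn2 : (2 : ℝ) < n := by exact_mod_cast hn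
  have hn1 : (n : ℝ) - 1 ≠ 0 := by linarith
  have hn22 : (2 : ℝ) * n - 2 ≠ 0 := by linarith
  have hγn' : ∀ v, mink (fderiv ℝ γ t v) (γ t) = 0 := fun v => by rw [mink_comm, hγn]
  have hηn' : ∀ v, mink (fderiv ℝ γ t v) η = 0 := fun v => by rw [mink_comm, h.normal]
  have hηγ : mink (γ t) η = -1 := by rw [mink_comm, h.pairing]
  -- The coefficient of `η` is forced by the pairing with `θ = (α γ, 0)`, the last coordinate by
  -- orthogonality to `∂_s = (α' γ, 1)`, and the coefficient of `γ` by `⟨ξ, ξ⟩ = 0`.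
  refine ⟨pairLast ((α s)⁻¹ • η + (deriv α s ^ 2 / (2 * α s)) • γ t) (deriv α s / α s),
    fun X => ?_, ?_, ?_, fun X Y => ?_⟩
  · rw [fderiv_warped hα1 hγ1, mink_pairLast]
    simp only [mink_add_left, mink_add_right, mink_smul_left, mink_smul_right, h.normal, h.pairing,
      hγn, hγγ]
    field_simp
    ring
  · rw [mink_pairLast]
    simp only [mink_add_left, mink_add_right, mink_smul_left, mink_smul_right, h.null, h.pairing,
      hηγ, hγγ]
    field_simp
    ring
  · rw [warped, dropLast_pairLast, mink_pairLast]
    simp only [mink_add_left, mink_smul_left, mink_smul_right, h.pairing, hγγ]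
    field_simp
    ring
  · rw [fderiv_warped hα1 hγ1, fderiv_warped hα1 hγ1, fderiv_fderiv_warped hα hγ, mink_pairLast,
      mink_pairLast, pairLast_last, pairLast_last]
    simp only [mink_add_left, mink_add_right, mink_smul_left, mink_smul_right, hηγ, hγγ, hγn,
      hγn', hηn', h.second, cone_second hγ hL, hk, warpFactor]
    field_simp
    ring

lemma UmbilicalFrame.coneFrame {ξ : Fin (n + 2) → ℝ} {b : ℝ} (hn : 2 < n)
    (h : UmbilicalFrame (warped α γ) (s, t) ξ b) (hα : ContDiffAt ℝ 2 α s)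
    (hγ : ContDiffAt ℝ 2 γ t) (hα0 : α s ≠ 0) (hL : ∀ᶠ y in 𝓝 t, γ y ∈ lightCone n) :
    ∃ η, ConeFrame γ t η (warpFactor n α s) := by
  have hα1 := hα.differentiableAt (by norm_num)
  have hγ1 := hγ.differentiableAt (by norm_num)
  have hγγ : mink (γ t) (γ t) = 0 := hL.self_of_nhds.1
  have hγn := cone_normal hγ1 hL
  have hn2 : (2 : ℝ) < n := by exact_mod_cast hn
  have hn1 : (n : ℝ) - 1 ≠ 0 := by linarith
  obtain ⟨ζ, y, rfl⟩ : ∃ ζ y, ξ = pairLast ζ y := ⟨_, _, (pairLast_init_last ξ).symm⟩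
  have hp := h.pairing
  rw [warped, dropLast_pairLast, mink_pairLast, mink_smul_right] at hp
  have hζγ : mink ζ (γ t) = -1 / α s := by
    field_simp
    linear_combination hp
  -- The frame conditions are now tested on `∂_s = (1, 0)` and on vectors `(0, v)`; the component
  -- `(∂_s, ∂_s)` determines `b`, and the components along `V` give the umbilicity of `γ`.
  have hy : y = deriv α s / α s := by
    have := h.normal (1, 0)
    rw [fderiv_warped hα1 hγ1, mink_pairLast] at this
    simp only [map_zero, smul_zero, add_zero, mink_smul_right, hζγ] at this
    field_simp at this ⊢
    linear_combination this
  have hζn : ∀ v, mink ζ (fderiv ℝ γ t v) = 0 := fun v => by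
    have := h.normal (0, v)
    rw [fderiv_warped hα1 hγ1, mink_pairLast] at this
    simpa [mink_smul_right, hα0] using this
  have hζζ : mink ζ ζ = -y ^ 2 := by
    have := h.null
    rw [mink_pairLast] at this
    linear_combination this
  have hb : b * (2 * (n - 1)) * α s = deriv (deriv α) s := by
    have := h.second (1, 0) (1, 0)
    rw [fderiv_warped hα1 hγ1, fderiv_fderiv_warped hα hγ, mink_pairLast, mink_pairLast,
      pairLast_last, mink_comm _ ζ] at this
    simp only [map_zero, smul_zero, add_zero, mink_smul_right, mink_smul_left, hζγ, hγγ] at this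
    field_simp at this
    linear_combination this
  have hs : ∀ v w, α s * mink (fderiv ℝ (fderiv ℝ γ) t v w) ζ =
      -(b * (n - 2) * α s ^ 2 * mink (fderiv ℝ γ t v) (fderiv ℝ γ t w)) := fun v w => by
    have := h.second (0, v) (0, w)
    rw [fderiv_warped hα1 hγ1, fderiv_warped hα1 hγ1, fderiv_fderiv_warped hα hγ, mink_pairLast,
      mink_pairLast, pairLast_last, pairLast_last] at this
    simp only [zero_mul, zero_smul, smul_zero, zero_add, add_zero, mul_zero, mink_smul_left,
      mink_smul_right] at this
    linear_combination this
  -- This inverts the formula for `ξ` used in `ConeFrame.umbilicalFrame_warped`.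
  refine ⟨α s • ζ - (deriv α s ^ 2 / 2) • γ t, fun v => ?_, ?_, ?_, fun v w => ?_⟩
  · rw [mink_sub_left, mink_smul_left, mink_smul_left, hζn, hγn]; ring
  · simp only [mink_sub_left, mink_sub_right, mink_smul_left, mink_smul_right, hζζ, hζγ, hγγ,
      mink_comm (γ t) ζ, hy]
    field_simp
    ring
  · simp only [mink_sub_left, mink_smul_left, hζγ, hγγ]
    field_simp
    ring
  · rw [mink_sub_right, mink_smul_right, mink_smul_right, hs, cone_second hγ hL, warpFactor, ← hb]
    field_simp
    ring

end Cone

/-! ### Linear systems for normal vectors -/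

section NormalSystem

variable {m : ℕ} {V : Type*} [NormedAddCommGroup V] [NormedSpace ℝ V]

lemma two_le_infty : (2 : WithTop ℕ∞) ≤ ∞ :=
  WithTop.coe_le_coe.2 (le_top (a := (2 : ℕ∞)))

/-- Near `t` the solution is `(A y)⁻¹ r`, and inversion of operators is smooth. This provides
regularity for a normal field that is only chosen pointwise. -/
lemma differentiableAt_of_linear_system {X Y : Type*} [NormedAddCommGroup X] [NormedSpace ℝ X]
    [NormedAddCommGroup Y] [NormedSpace ℝ Y] [CompleteSpace X] {A : V → X →L[ℝ] Y} {u : V → X}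
    {r : Y} {t : V} (hA : DifferentiableAt ℝ A t) (hinv : ∀ᶠ y in 𝓝 t, (A y).IsInvertible)
    (hu : ∀ᶠ y in 𝓝 t, A y (u y) = r) : DifferentiableAt ℝ u t := by
  have h1 : DifferentiableAt ℝ (fun y => (A y).inverse r) t :=
    ((hinv.self_of_nhds.contDiffAt_map_inverse (n := 1)).differentiableAt (by norm_num)
      |>.comp t hA).clm_apply (differentiableAt_const _)
  refine h1.congr_of_eventuallyEq ?_
  filter_upwards [hinv, hu] with y hy hy'
  rw [← hy']
  obtain ⟨M, hM⟩ := hy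
  rw [← hM]
  simp

/-- A vector field determined by its Lorentzian products with differentiable vector fields is
differentiable. -/
lemma differentiableAt_of_mink_system {ι : Type*} [Fintype ι] [DecidableEq ι]
    (hι : Fintype.card ι = m + 1) {w : ι → V → (Fin (m + 1) → ℝ)} {u : V → (Fin (m + 1) → ℝ)}
    {r : ι → ℝ} {t : V} (hw : ∀ i, DifferentiableAt ℝ (w i) t)
    (hinj : ∀ᶠ y in 𝓝 t, ∀ x, (∀ i, mink x (w i y) = 0) → x = 0)
    (hu : ∀ᶠ y in 𝓝 t, ∀ i, mink (u y) (w i y) = r i) : DifferentiableAt ℝ u t := by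
  let A : V → (Fin (m + 1) → ℝ) →L[ℝ] (ι → ℝ) := fun y =>
    ∑ i, (ContinuousLinearMap.toSpanSingleton ℝ (Pi.single i 1 : ι → ℝ)) ∘L
      (minkCLM m).flip (w i y)
  have hA : ∀ y x i, A y x i = mink x (w i y) := fun y x i => by
    simp [A, Finset.sum_apply, Pi.single_apply]
  refine differentiableAt_of_linear_system (A := A) (r := r) ?_ ?_ ?_
  · exact DifferentiableAt.fun_sum fun i _ => (differentiableAt_const _).clm_comp
      ((minkCLM m).flip.differentiableAt.comp t (hw i))
  · filter_upwards [hinj] with y hy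
    have hAinj : Function.Injective (A y) := by
      rw [injective_iff_map_eq_zero]
      exact fun x hx => hy x fun i => by rw [← hA, hx]; rfl
    exact ⟨(LinearEquiv.ofInjectiveOfFinrankEq (A y).toLinearMap hAinj
      (by simp [hι])).toContinuousLinearEquiv, by ext1 x; rfl⟩
  · filter_upwards [hu] with y hy
    funext i
    rw [hA, hy]

end NormalSystem

/-! ### Umbilical submanifolds of the light cone of codimension two -/

section ConstantVector

variable {m : ℕ} {V : Type*} [NormedAddCommGroup V] [NormedSpace ℝ V] [FiniteDimensional ℝ V]
  {γ : V → (Fin (m + 1) → ℝ)} {t : V}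

/-- A Lorentzian plane has just two light-like lines. Two normals with the same pairing with `γ t`
differ by a multiple of `γ t`, and being light-like makes that multiple zero. -/
lemma ConeFrame.unique (hdim : Module.finrank ℝ V + 1 = m) (hnd : NondegenerateAt γ t)
    (hγ : DifferentiableAt ℝ γ t) (hL : ∀ᶠ y in 𝓝 t, γ y ∈ lightCone m)
    {η η' : Fin (m + 1) → ℝ} {k k' : ℝ} (h : ConeFrame γ t η k) (h' : ConeFrame γ t η' k') :
    η = η' := by
  have hγγ : mink (γ t) (γ t) = 0 := hL.self_of_nhds.1
  have hγn := cone_normal hγ hL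
  have hγη : mink (γ t) η = -1 := by rw [mink_comm, h.pairing]
  have key : (η' - η) + mink (η' - η) η • γ t = 0 := by
    refine eq_zero_of_orthogonal (J := (fderiv ℝ γ t).toLinearMap) hdim hnd hγn h.normal hγγ
      h.pairing (fun X => ?_) ?_ ?_
    · simp [mink_add_left, mink_sub_left, mink_smul_left, h.normal, h'.normal, hγn]
    · simp [mink_add_left, mink_sub_left, mink_smul_left, h.pairing, h'.pairing, hγγ]
    · simp [mink_add_left, mink_sub_left, mink_smul_left, h.null, hγη]
  have hη' : η' = η - mink (η' - η) η • γ t := by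
    rw [eq_sub_iff_add_eq, ← sub_eq_zero]
    rw [← key]; abel
  set z := mink (η' - η) η
  have hz : z = 0 := by
    have := h'.null
    rw [hη'] at this
    simp only [mink_sub_left, mink_sub_right, mink_smul_left, mink_smul_right, h.null, hγη,
      h.pairing, hγγ] at this
    linarith
  rw [hη', hz]; simp

lemma ConeFrame.factor_unique [Nontrivial V] (hdim : Module.finrank ℝ V + 1 = m)
    (hpos : ∀ X, X ≠ 0 → 0 < mink (fderiv ℝ γ t X) (fderiv ℝ γ t X)) (hnd : NondegenerateAt γ t)
    (hγ : DifferentiableAt ℝ γ t) (hL : ∀ᶠ y in 𝓝 t, γ y ∈ lightCone m)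
    {η η' : Fin (m + 1) → ℝ} {k k' : ℝ} (h : ConeFrame γ t η k) (h' : ConeFrame γ t η' k') :
    k = k' := by
  have he := h.unique hdim hnd hγ hL h'
  subst he
  obtain ⟨v, hv⟩ := exists_ne (0 : V)
  have h1 := h.second v v
  rw [h'.second v v] at h1
  have := (hpos v hv).ne'
  have h2 := neg_injective h1
  exact (mul_right_cancel₀ this h2).symm

/-- The vector `η - k γ` is constant along an umbilical submanifold of the light cone. -/
lemma exists_constant_vector [Nontrivial V] {W : Set V} {k : ℝ}
    (hdim : Module.finrank ℝ V + 1 = m) (hW : IsOpen W) (hW' : IsPreconnected W)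
    (hγ : ContDiffOn ℝ ∞ γ W) (hL : ∀ t ∈ W, γ t ∈ lightCone m)
    (hpos : ∀ t ∈ W, ∀ X, X ≠ 0 → 0 < mink (fderiv ℝ γ t X) (fderiv ℝ γ t X))
    (hf : ∀ t ∈ W, ∃ η, ConeFrame γ t η k) :
    ∃ u, ∀ t ∈ W, ConeFrame γ t (u + k • γ t) k := by
  choose! η hη using hf
  have hnd : ∀ t ∈ W, NondegenerateAt γ t := fun t ht X hX => by
    by_contra hne
    exact (hpos t ht X hne).ne' (hX X)
  have hLe : ∀ t ∈ W, ∀ᶠ y in 𝓝 t, γ y ∈ lightCone m := fun t ht =>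
    Filter.mem_of_superset (hW.mem_nhds ht) hL
  have hγt : ∀ t ∈ W, ContDiffAt ℝ ∞ γ t := fun t ht => hγ.contDiffAt (hW.mem_nhds ht)
  have hγ2 : ∀ t ∈ W, ContDiffAt ℝ 2 γ t := fun t ht => (hγt t ht).of_le two_le_infty
  have hγ1 : ∀ t ∈ W, DifferentiableAt ℝ γ t := fun t ht =>
    (hγt t ht).differentiableAt (by simp)
  set u : V → (Fin (m + 1) → ℝ) := fun t => η t - k • γ t with hu
  have hγη : ∀ t ∈ W, mink (γ t) (η t) = -1 := fun t ht => by rw [mink_comm, (hη t ht).pairing]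
  have hγγ : ∀ t ∈ W, mink (γ t) (γ t) = 0 := fun t ht => (hL t ht).1
  have hun : ∀ t ∈ W, ∀ v, mink (u t) (fderiv ℝ γ t v) = 0 := fun t ht v => by
    simp [hu, mink_sub_left, mink_smul_left, (hη t ht).normal, cone_normal (hγ1 t ht) (hLe t ht)]
  have huγ : ∀ t ∈ W, mink (u t) (γ t) = -1 := fun t ht => by
    simp [hu, mink_sub_left, mink_smul_left, (hη t ht).pairing, hγγ t ht]
  have huu : ∀ t ∈ W, mink (u t) (u t) = 2 * k := fun t ht => by
    simp only [hu, mink_sub_left, mink_sub_right, mink_smul_left, mink_smul_right, (hη t ht).null,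
      hγη t ht, (hη t ht).pairing, hγγ t ht]
    ring
  have hu2 : ∀ t ∈ W, ∀ v w, mink (fderiv ℝ (fderiv ℝ γ) t v w) (u t) = 0 := fun t ht v w => by
    simp [hu, mink_sub_right, mink_smul_right, (hη t ht).second,
      cone_second (hγ2 t ht) (hLe t ht)]
  obtain ⟨e, he⟩ := exists_ne (0 : V)
  let B := Module.finBasis ℝ V
  -- These `m + 1` smooth fields have constant products `-1`, `0`, `0` with `u`. They determine it
  -- because `⟨∂ₑ∂ₑγ, γ⟩ = -⟨∂ₑγ, ∂ₑγ⟩ ≠ 0`, so the second derivative is not orthogonal to `γ`, the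
  -- one direction left undetected by `γ` and its first derivatives.
  let w : Option (Option (Fin (Module.finrank ℝ V))) → V → (Fin (m + 1) → ℝ) := fun i y =>
    i.elim (γ y) fun j => j.elim (fderiv ℝ (fderiv ℝ γ) y e e) fun l => fderiv ℝ γ y (B l)
  have hinj : ∀ y ∈ W, ∀ x, (∀ i, mink x (w i y) = 0) → x = 0 := fun t ht x hx => by
    have h1 : ∀ v, mink x (fderiv ℝ γ t v) = 0 := fun v => by
      have : (minkCLM m x).toLinearMap ∘ₗ (fderiv ℝ γ t).toLinearMap = 0 :=
        B.ext fun l => hx (some (some l))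
      exact congrArg (fun L => L v) this
    have key : x + mink x (η t) • γ t = 0 := by
      refine eq_zero_of_orthogonal (J := (fderiv ℝ γ t).toLinearMap) hdim (hnd t ht)
        (cone_normal (hγ1 t ht) (hLe t ht)) (hη t ht).normal (hγγ t ht) (hη t ht).pairing
        (fun X => ?_) ?_ ?_
      · simp [mink_add_left, mink_smul_left, h1, cone_normal (hγ1 t ht) (hLe t ht)]
      · have : mink x (γ t) = 0 := hx none
        simp [mink_add_left, mink_smul_left, this, hγγ t ht]
      · simp [mink_add_left, mink_smul_left, hγη t ht]
    have hxe := eq_neg_of_add_eq_zero_left key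
    have h3 : mink x (fderiv ℝ (fderiv ℝ γ) t e e) = 0 := hx (some none)
    rw [hxe, mink_neg_left, mink_smul_left, mink_comm (γ t), cone_second (hγ2 t ht) (hLe t ht)]
      at h3
    have h0 : mink x (η t) = 0 := by
      have := (hpos t ht e he).ne'
      simpa [this] using h3
    rw [hxe, h0]; simp
  have hud : ∀ t ∈ W, DifferentiableAt ℝ u t := fun t ht => by
    have hWt := hW.mem_nhds ht
    have hγ' : ContDiffAt ℝ ∞ (fderiv ℝ γ) t := (hγt t ht).fderiv_right (by simp)
    have hγ'' : ContDiffAt ℝ ∞ (fderiv ℝ (fderiv ℝ γ)) t := hγ'.fderiv_right (by simp)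
    refine differentiableAt_of_mink_system (w := w) (r := fun i => i.elim (-1) fun _ => 0)
      (by simp; omega) (fun i => ?_) (Filter.mem_of_superset hWt hinj)
      (Filter.mem_of_superset hWt fun y hy i => ?_)
    · rcases i with _ | _ | l
      · exact hγ1 t ht
      · exact ((hγ''.differentiableAt (by simp)).clm_apply (differentiableAt_const e)).clm_apply
          (differentiableAt_const e)
      · exact (hγ'.differentiableAt (by simp)).clm_apply (differentiableAt_const (B l))
    · rcases i with _ | _ | l
      · exact huγ y hy
      · exact (mink_comm _ _).trans (hu2 y hy e e)
      · exact hun y hy (B l)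
  have hud0 : ∀ t ∈ W, fderiv ℝ u t = 0 := fun t ht => by
    have hWt := hW.mem_nhds ht
    ext1 X
    -- The pair `γ`, `u` serves here in place of `γ`, `η`: only `⟨γ, γ⟩ = 0` and `⟨u, γ⟩ = -1`
    -- matter. Each product with the derivative of `u` vanishes because the corresponding product
    -- with `u` is constant.
    refine eq_zero_of_orthogonal (J := (fderiv ℝ γ t).toLinearMap) hdim (hnd t ht)
        (cone_normal (hγ1 t ht) (hLe t ht)) (hun t ht) (hγγ t ht) (huγ t ht)
        (fun Y => ?_) ?_ ?_
    · have := mink_second_add (hγ2 t ht) (hud t ht) (w := Y)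
        (Filter.mem_of_superset hWt fun y hy => hun y hy Y) X
      rwa [hu2 t ht, zero_add] at this
    · have := mink_fderiv_add (hud t ht) (hγ1 t ht)
        (Filter.mem_of_superset hWt fun y hy => huγ y hy) X
      rwa [hun t ht, zero_add] at this
    · have := mink_fderiv_add (hud t ht) (hud t ht)
        (Filter.mem_of_superset hWt fun y hy => huu y hy) X
      rw [mink_comm (u t)] at this
      linarith
  rcases W.eq_empty_or_nonempty with rfl | ⟨t0, ht0⟩
  · exact ⟨0, fun t ht => ht.elim⟩
  · refine ⟨u t0, fun t ht => ?_⟩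
    have : u t = u t0 := hW.is_const_of_fderiv_eq_zero hW'
      (fun y hy => (hud y hy).differentiableWithinAt) (fun y hy => hud0 y hy) ht ht0
    rw [← this]
    simpa [hu] using hη t ht

end ConstantVector

/-! ### Warped form of pseudo-umbilical submanifolds in adapted coordinates -/

section Factorization

variable {n : ℕ} {V : Type*} [NormedAddCommGroup V] [NormedSpace ℝ V]

lemma init_height_gradient (x : Fin (n + 2) → ℝ) (z : ℝ) :
    (Fin.init (lastVec n + z • dropLast n x) : Fin (n + 1) → ℝ) = z • Fin.init x := by
  have h : ∀ y, (Fin.init y : Fin (n + 1) → ℝ) = initCLM n y := fun y => rfl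
  rw [h, map_add, map_smul, ← h, ← h, lastVec, dropLast_apply, init_pairLast, init_pairLast]
  simp

variable {F : ℝ × V → (Fin (n + 2) → ℝ)} {I : Set ℝ} {W : Set V}

/-- The logarithmic derivative of `F` along the first coordinate. -/
noncomputable def logDerivFst (F : ℝ × V → (Fin (n + 2) → ℝ)) (y : ℝ × V) : ℝ :=
  fderiv ℝ F y (1, 0) 0 / F y 0

/-- The coordinate of index `0` identifies `z`, since it vanishes on `∂_{x_{n+2}}` and is positive
on the cone; this exhibits `z` as a smooth function. -/
lemma fderiv_fst_eq {y : ℝ × V} (hL : F y ∈ lightCylinder n)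
    (hT : ∃ z : ℝ, fderiv ℝ F y (1, 0) = lastVec n + z • dropLast n (F y)) :
    fderiv ℝ F y (1, 0) = lastVec n + logDerivFst F y • dropLast n (F y) := by
  obtain ⟨z, hz⟩ := hT
  have h0 : F y 0 ≠ 0 := hL.2.ne'
  have h1 : (lastVec n + z • dropLast n (F y)) 0 = z * F y 0 :=
    congrFun (init_height_gradient (F y) z) 0
  have : logDerivFst F y = z := by
    rw [logDerivFst, hz, h1, mul_div_cancel_right₀ _ h0]
  rw [this, hz]

/-- The `i`-th coordinate as a linear form. -/
def coordCLM (n : ℕ) (i : Fin (n + 2)) : (Fin (n + 2) → ℝ) →L[ℝ] ℝ :=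
  ContinuousLinearMap.proj (R := ℝ) (φ := fun _ => ℝ) i

lemma hasFDerivAt_coord {E : Type*} [NormedAddCommGroup E] [NormedSpace ℝ E]
    {F : E → (Fin (n + 2) → ℝ)} {x : E} (hF : DifferentiableAt ℝ F x) (i : Fin (n + 2)) :
    HasFDerivAt (fun y => F y i) (coordCLM n i ∘L fderiv ℝ F x) x :=
  (coordCLM n i).hasFDerivAt.comp x hF.hasFDerivAt

lemma fderiv_last {y : ℝ × V} (hF : DifferentiableAt ℝ F y)
    (hlast : ∀ᶠ y in 𝓝 y, F y (Fin.last _) = y.1) (X : ℝ × V) :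
    fderiv ℝ F y X (Fin.last _) = X.1 :=
  congrArg (fun L => L X) ((hasFDerivAt_coord hF (Fin.last (n + 1))).unique
    (hasFDerivAt_fst.congr_of_eventuallyEq hlast))

lemma contDiffAt_logDerivFst {y : ℝ × V} (hF : ContDiffAt ℝ ∞ F y) (h0 : F y 0 ≠ 0) :
    ContDiffAt ℝ ∞ (logDerivFst F) y := by
  have h1 : ContDiffAt ℝ ∞ (fun y => fderiv ℝ F y (1, 0)) y :=
    (hF.fderiv_right (m := ∞) (by simp)).clm_apply contDiffAt_const
  exact (contDiffAt_pi.1 h1 0).div (contDiffAt_pi.1 hF 0) h0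

/-- Pairing the derivative of `∂_s F = ∂_{x_{n+2}} + z θ` along `(0, v)` with `ξ` leaves `-dz(0,
v)`. The frame condition makes it zero, because `∂_s` is the gradient of `s` and hence orthogonal to
`(0, v)`. -/
lemma fderiv_logDerivFst {y : ℝ × V} (hF : ContDiffAt ℝ ∞ F y)
    (hL : ∀ᶠ y in 𝓝 y, F y ∈ lightCylinder n)
    (hlast : ∀ᶠ y in 𝓝 y, F y (Fin.last _) = y.1)
    (hT : ∀ᶠ y in 𝓝 y, ∃ z : ℝ, fderiv ℝ F y (1, 0) = lastVec n + z • dropLast n (F y))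
    (hU : ∃ ξ b, UmbilicalFrame F y ξ b) (v : V) : fderiv ℝ (logDerivFst F) y (0, v) = 0 := by
  have hF1 : DifferentiableAt ℝ F y := hF.differentiableAt (by simp)
  obtain ⟨ξ, b, h⟩ := hU
  have hev : (fun y => fderiv ℝ F y (1, 0)) =ᶠ[𝓝 y]
      fun y => lastVec n + logDerivFst F y • dropLast n (F y) := by
    filter_upwards [hL, hT] with y hy hy'
    exact fderiv_fst_eq hy hy'
  have hz := ((contDiffAt_logDerivFst hF hL.self_of_nhds.2.ne').differentiableAt
    (by simp)).hasFDerivAt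
  have hd : HasFDerivAt (fun y => dropLast n (F y)) (dropLast n ∘L fderiv ℝ F y) y :=
    (dropLast n).hasFDerivAt.comp y hF1.hasFDerivAt
  have hsum : HasFDerivAt (fun y => lastVec n + logDerivFst F y • dropLast n (F y)) _ y :=
    (hz.smul hd).const_add (lastVec n)
  have h2 := h.second (0, v) (1, 0)
  rw [fderiv_fderiv_apply (hF.of_le two_le_infty), hev.fderiv_eq,
    hsum.fderiv, fderiv_last hF1 hlast, fderiv_last hF1 hlast,
    mink_comm (fderiv ℝ F y _) (fderiv ℝ F y _),
    mink_height_gradient (fderiv_fst_eq hL.self_of_nhds hT.self_of_nhds) (theta_normal hF1 hL _),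
    fderiv_last hF1 hlast, mink_comm _ ξ] at h2
  simp only [add_apply, smul_apply, ContinuousLinearMap.smulRight_apply,
    ContinuousLinearMap.comp_apply, mink_add_right, mink_smul_right, h.pairing,
    mink_dropLast_right ξ, h.normal, fderiv_last hF1 hlast] at h2
  linarith

lemma exists_warped (hI : IsOpen I) (hI' : IsPreconnected I) (hW : IsOpen W)
    (hW' : IsPreconnected W) {s₀ : ℝ} {t₀ : V} (hs₀ : s₀ ∈ I) (ht₀ : t₀ ∈ W)
    (hF : ContDiffOn ℝ ∞ F (I ×ˢ W)) (hL : ∀ y ∈ I ×ˢ W, F y ∈ lightCylinder n)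
    (hlast : ∀ y ∈ I ×ˢ W, F y (Fin.last _) = y.1)
    (hT : ∀ y ∈ I ×ˢ W, ∃ z : ℝ, fderiv ℝ F y (1, 0) = lastVec n + z • dropLast n (F y))
    (hU : ∀ y ∈ I ×ˢ W, ∃ ξ b, UmbilicalFrame F y ξ b) :
    ∃ (α : ℝ → ℝ) (γ : V → (Fin (n + 1) → ℝ)), ContDiffOn ℝ ∞ α I ∧ (∀ s ∈ I, α s ≠ 0) ∧
      ContDiffOn ℝ ∞ γ W ∧ (∀ t ∈ W, γ t ∈ lightCone n) ∧ ∀ y ∈ I ×ˢ W, F y = warped α γ y := by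
  have hO : IsOpen (I ×ˢ W) := hI.prod hW
  have hnhds : ∀ y ∈ I ×ˢ W, I ×ˢ W ∈ 𝓝 y := fun y hy => hO.mem_nhds hy
  have hFa : ∀ y ∈ I ×ˢ W, ContDiffAt ℝ ∞ F y := fun y hy => hF.contDiffAt (hnhds y hy)
  have hF1 : ∀ y ∈ I ×ˢ W, DifferentiableAt ℝ F y := fun y hy => (hFa y hy).differentiableAt (by simp)
  have h0 : ∀ y ∈ I ×ˢ W, F y 0 ≠ 0 := fun y hy => (hL y hy).2.ne'
  have hz0 : ∀ y ∈ I ×ˢ W, ∀ v, fderiv ℝ (logDerivFst F) y (0, v) = 0 := fun y hy =>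
    fderiv_logDerivFst (hFa y hy) (Filter.mem_of_superset (hnhds y hy) hL)
      (Filter.mem_of_superset (hnhds y hy) hlast) (Filter.mem_of_superset (hnhds y hy) hT) (hU y hy)
  have hzd : ∀ y ∈ I ×ˢ W, DifferentiableAt ℝ (logDerivFst F) y := fun y hy =>
    (contDiffAt_logDerivFst (hFa y hy) (h0 y hy)).differentiableAt (by simp)
  have hz : ∀ s ∈ I, ∀ t ∈ W, logDerivFst F (s, t) = logDerivFst F (s, t₀) := fun s hs t ht => by
    have hd : ∀ t ∈ W, HasFDerivAt (fun t => logDerivFst F (s, t))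
        (fderiv ℝ (logDerivFst F) (s, t) ∘L ContinuousLinearMap.inr ℝ ℝ V) t := fun t ht =>
      (hzd (s, t) ⟨hs, ht⟩).hasFDerivAt.comp t (hasFDerivAt_prodMk_right s t)
    refine hW.is_const_of_fderiv_eq_zero (f := fun t => logDerivFst F (s, t)) (𝕜 := ℝ) hW'
      (fun y hy => (hd y hy).differentiableAt.differentiableWithinAt) (fun y hy => ?_) ht ht₀
    rw [(hd y hy).fderiv]
    ext v
    exact hz0 (s, y) ⟨hs, hy⟩ v
  have hFs : ∀ s ∈ I, ∀ t ∈ W, HasDerivAt (fun s => F (s, t))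
      (lastVec n + logDerivFst F (s, t₀) • dropLast n (F (s, t))) s := fun s hs t ht => by
    have h1 := (hF1 (s, t) ⟨hs, ht⟩).hasFDerivAt.comp_hasDerivAt s
      ((hasDerivAt_id s).prodMk (hasDerivAt_const s t))
    rw [fderiv_fst_eq (hL _ ⟨hs, ht⟩) (hT _ ⟨hs, ht⟩), hz s hs t ht] at h1
    exact h1
  have hinit : ∀ s ∈ I, ∀ t ∈ W, HasDerivAt (fun s => (Fin.init (F (s, t)) : Fin (n + 1) → ℝ))
      (logDerivFst F (s, t₀) • Fin.init (F (s, t))) s := fun s hs t ht => by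
    have h1 := (initCLM n).hasFDerivAt.comp_hasDerivAt s (hFs s hs t ht)
    rw [initCLM_apply, init_height_gradient] at h1
    exact h1
  -- Normalized by `α s₀ = 1`, so that `γ` is the slice of `F` at height `s₀`.
  set α : ℝ → ℝ := fun s => F (s, t₀) 0 / F (s₀, t₀) 0 with hα
  have hα0 : ∀ s ∈ I, α s ≠ 0 := fun s hs => div_ne_zero (h0 _ ⟨hs, ht₀⟩) (h0 _ ⟨hs₀, ht₀⟩)
  have hαd : ∀ s ∈ I, HasDerivAt α (logDerivFst F (s, t₀) * α s) s := fun s hs => by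
    have h1 := (hasDerivAt_pi.1 (hinit s hs t₀ ht₀) 0).div_const (F (s₀, t₀) 0)
    refine h1.congr_deriv ?_
    rw [hα, Pi.smul_apply, smul_eq_mul, mul_div_assoc]
    rfl
  have hα1 : α s₀ = 1 := div_self (h0 _ ⟨hs₀, ht₀⟩)
  refine ⟨α, fun t => Fin.init (F (s₀, t)), ?_, hα0, ?_, fun t ht => hL _ ⟨hs₀, ht⟩, ?_⟩
  · have h1 : ContDiffOn ℝ ∞ (fun s => F (s, t₀)) I :=
      hF.comp (contDiff_id.prodMk contDiff_const).contDiffOn fun s hs => ⟨hs, ht₀⟩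
    exact (contDiffOn_pi.1 h1 0).div_const _
  · have h1 : ContDiffOn ℝ ∞ (fun t => F (s₀, t)) W :=
      hF.comp (contDiff_const.prodMk contDiff_id).contDiffOn fun t ht => ⟨hs₀, ht⟩
    exact (initCLM n).contDiff.comp_contDiffOn h1
  · rintro ⟨s, t⟩ ⟨hs, ht⟩
    -- For each `t`, `α` and the cone component of `F` solve the same linear equation `y' = z(s) y`,
    -- so their quotient is constant in `s`.
    have hQ : ∀ s ∈ I, HasDerivAt (fun s => (α s)⁻¹ • (Fin.init (F (s, t)) : Fin (n + 1) → ℝ))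
        0 s := fun s hs => by
      have h1 := ((hαd s hs).inv (hα0 s hs)).smul (hinit s hs t ht)
      refine h1.congr_deriv ?_
      rw [smul_smul, ← add_smul]
      have := hα0 s hs
      rw [show α⁻¹ s * logDerivFst F (s, t₀) + -(logDerivFst F (s, t₀) * α s) / α s ^ 2 = 0 by
        rw [Pi.inv_apply]; field_simp; ring, zero_smul]
    have hc : (α s)⁻¹ • (Fin.init (F (s, t)) : Fin (n + 1) → ℝ) =
        (α s₀)⁻¹ • (Fin.init (F (s₀, t)) : Fin (n + 1) → ℝ) :=
      hI.is_const_of_deriv_eq_zero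
        (f := fun s => (α s)⁻¹ • (Fin.init (F (s, t)) : Fin (n + 1) → ℝ)) hI'
        (fun y hy => (hQ y hy).differentiableAt.differentiableWithinAt)
        (fun y hy => (hQ y hy).deriv) hs hs₀
    rw [hα1, inv_one, one_smul, inv_smul_eq_iff₀ (hα0 s hs)] at hc
    rw [warped, ← hc, ← hlast _ ⟨hs, ht⟩, pairLast_init_last]

end Factorization

/-! ### Total umbilicity of `γ`, normalization of `a` and the differential equation. -/

section Conclusion

variable {n : ℕ}

lemma contDiffOn_mink {E : Type*} [NormedAddCommGroup E] [NormedSpace ℝ E] {m : ℕ}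
    {f g : E → (Fin (m + 1) → ℝ)} {W : Set E} (hf : ContDiffOn ℝ ∞ f W) (hg : ContDiffOn ℝ ∞ g W) :
    ContDiffOn ℝ ∞ (fun t => mink (f t) (g t)) W := by
  rw [contDiffOn_pi] at hf hg
  exact ((hf 0).mul (hg 0)).neg.add
    (ContDiffOn.sum fun i _ => (hf i.succ).mul (hg i.succ))

/-- The normal plane is spanned by `γ` and `η = u + k γ`, along which `γ` is umbilical with factors
`-1` and `-k`; any normal `ζ` equals `-(⟨ζ, η⟩ γ + ⟨ζ, γ⟩ η)`. -/
lemma isTotallyUmbilicalOn_of_coneFrame {d m : ℕ} {γ : EuclideanSpace ℝ (Fin d) → (Fin (m + 1) → ℝ)}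
    {W : Set (EuclideanSpace ℝ (Fin d))} (hdim : d + 1 = m) (hW : IsOpen W)
    (hγ : ContDiffOn ℝ ∞ γ W) (hL : ∀ t ∈ W, γ t ∈ lightCone m)
    (hnd : ∀ t ∈ W, NondegenerateAt γ t) {u : Fin (m + 1) → ℝ} {k : ℝ}
    (hu : ∀ t ∈ W, ConeFrame γ t (u + k • γ t) k) : IsTotallyUmbilicalOn γ W := by
  intro ζ hζ hζn
  have h1 : ContDiffOn ℝ ∞ (fun t => u + k • γ t) W := contDiffOn_const.add (hγ.const_smul k)
  have h2 : ContDiffOn ℝ ∞ (fun t => mink (ζ t) (u + k • γ t)) W := contDiffOn_mink hζ h1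
  have h3 : ContDiffOn ℝ ∞ (fun t => k * mink (ζ t) (γ t)) W :=
    contDiffOn_const.mul (contDiffOn_mink hζ hγ)
  refine ⟨fun t => mink (ζ t) (u + k • γ t) + k * mink (ζ t) (γ t),
    h2.add h3, fun t ht X Y => ?_⟩
  have hγt : ContDiffAt ℝ 2 γ t := (hγ.contDiffAt (hW.mem_nhds ht)).of_le two_le_infty
  have hLe : ∀ᶠ y in 𝓝 t, γ y ∈ lightCone m := Filter.mem_of_superset (hW.mem_nhds ht) hL
  have hγγ : mink (γ t) (γ t) = 0 := (hL t ht).1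
  have hγn := cone_normal (hγt.differentiableAt (by norm_num)) hLe
  have hη := hu t ht
  set η := u + k • γ t with hηdef
  have hγη : mink (γ t) η = -1 := by rw [mink_comm, hη.pairing]
  have key : ζ t + (mink (ζ t) η • γ t + mink (ζ t) (γ t) • η) = 0 := by
    refine eq_zero_of_orthogonal (J := (fderiv ℝ γ t).toLinearMap) (by simpa using hdim) (hnd t ht)
      hγn hη.normal hγγ hη.pairing (fun X => ?_) ?_ ?_
    · simp [mink_add_left, mink_smul_left, hη.normal, hγn, hζn t ht]
    · simp [mink_add_left, mink_smul_left, hη.pairing, hγγ]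
    · simp [mink_add_left, mink_smul_left, hη.null, hγη]
  rw [shapeForm, secondForm, mink_normalPart (hζn t ht), inducedMetric]
  conv_lhs => rw [eq_neg_of_add_eq_zero_left key]
  rw [mink_neg_right, mink_add_right, mink_smul_right, mink_smul_right, hη.second,
    cone_second hγt hLe]
  ring

/-- The constant vector has square `2k`; scaling it by `τ = |2k|^(-1/2)`, or by `1` when `k = 0`,
gives square `c`. -/
lemma exists_normalization (k : ℝ) :
    ∃ c τ : ℝ, (c = 1 ∨ c = -1 ∨ c = 0) ∧ 0 < τ ∧ c = τ ^ 2 * (2 * k) := by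
  rcases lt_trichotomy k 0 with hk | rfl | hk
  · refine ⟨-1, (√(-2 * k))⁻¹, by simp, inv_pos.2 (Real.sqrt_pos.2 (by linarith)), ?_⟩
    have := hk.ne
    rw [inv_pow, Real.sq_sqrt (by linarith)]
    field_simp
  · exact ⟨0, 1, by simp, one_pos, by simp⟩
  · refine ⟨1, (√(2 * k))⁻¹, by simp, inv_pos.2 (Real.sqrt_pos.2 (by linarith)), ?_⟩
    rw [inv_pow, Real.sq_sqrt (by linarith)]
    field_simp

lemma warped_data (hn : 2 < n) {I : Set ℝ} {W : Set (EuclideanSpace ℝ (Fin (n - 1)))} {α : ℝ → ℝ}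
    {γ : EuclideanSpace ℝ (Fin (n - 1)) → (Fin (n + 1) → ℝ)} (hI : IsOpen I) (hIne : I.Nonempty)
    (hW : IsOpen W) (hW' : IsPreconnected W) (hWne : W.Nonempty) (hα : ContDiffOn ℝ ∞ α I)
    (hα0 : ∀ s ∈ I, α s ≠ 0) (hγ : ContDiffOn ℝ ∞ γ W) (hL : ∀ t ∈ W, γ t ∈ lightCone n)
    (hnd : ∀ y ∈ I ×ˢ W, NondegenerateAt (warped α γ) y)
    (hU : ∀ y ∈ I ×ˢ W, ∃ ξ b, UmbilicalFrame (warped α γ) y ξ b) :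
    ∃ (a : Fin (n + 1) → ℝ) (c τ : ℝ), a ≠ 0 ∧ mink a a = c ∧ (c = 1 ∨ c = -1 ∨ c = 0) ∧ 0 < τ ∧
      IsSpacelikeOn γ W ∧ (∀ t ∈ W, γ t ∈ sigmaSet a τ) ∧ IsTotallyUmbilicalOn γ W ∧
      ∀ s ∈ I, ((n : ℝ) - 2) * τ ^ 2 * α s * deriv (deriv α) s
            - ((n : ℝ) - 1) * (c + τ ^ 2 * (deriv α s) ^ 2) = 0 := by
  have hdim : Module.finrank ℝ (EuclideanSpace ℝ (Fin (n - 1))) + 1 = n := by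
    rw [finrank_euclideanSpace_fin]; omega
  have : Nontrivial (EuclideanSpace ℝ (Fin (n - 1))) :=
    Module.nontrivial_of_finrank_pos (R := ℝ) (by omega)
  have hαt : ∀ s ∈ I, ContDiffAt ℝ 2 α s := fun s hs =>
    (hα.contDiffAt (hI.mem_nhds hs)).of_le two_le_infty
  have hγt : ∀ t ∈ W, ContDiffAt ℝ 2 γ t := fun t ht =>
    (hγ.contDiffAt (hW.mem_nhds ht)).of_le two_le_infty
  have hγ1 : ∀ t ∈ W, DifferentiableAt ℝ γ t := fun t ht =>
    (hγt t ht).differentiableAt (by norm_num)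
  have hLe : ∀ t ∈ W, ∀ᶠ y in 𝓝 t, γ y ∈ lightCone n := fun t ht =>
    Filter.mem_of_superset (hW.mem_nhds ht) hL
  obtain ⟨s₀, hs₀⟩ := hIne
  obtain ⟨t₀, ht₀⟩ := hWne
  have hpos : ∀ t ∈ W, ∀ X, X ≠ 0 → 0 < mink (fderiv ℝ γ t X) (fderiv ℝ γ t X) := by
    intro t ht X hX
    have hγn := cone_normal (hγ1 t ht) (hLe t ht)
    obtain ⟨h1, h2⟩ := mink_self_eq_zero_of_orthogonal (hL t ht)
      (by rw [mink_comm]; exact hγn X)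
    refine lt_of_le_of_ne h1 fun h0 => hX ?_
    obtain ⟨z, hz⟩ := h2 h0.symm
    -- If `dγ X = z γ`, then `(0, X)` maps to a multiple of `θ`, which is orthogonal to the whole
    -- tangent space.
    have := hnd (s₀, t) ⟨hs₀, ht⟩ (0, X) fun Y => by
      rw [fderiv_warped ((hαt s₀ hs₀).differentiableAt (by norm_num)) (hγ1 t ht),
        fderiv_warped ((hαt s₀ hs₀).differentiableAt (by norm_num)) (hγ1 t ht), mink_pairLast, hz]
      simp [mink_add_right, mink_smul_left, mink_smul_right, hγn, (hL t ht).1]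
    exact congrArg Prod.snd this
  have hγnd : ∀ t ∈ W, NondegenerateAt γ t := fun t ht X hX => by
    by_contra hne
    exact (hpos t ht X hne).ne' (hX X)
  have hframe : ∀ s ∈ I, ∀ t ∈ W, ∃ η, ConeFrame γ t η (warpFactor n α s) := fun s hs t ht => by
    obtain ⟨ξ, b, h⟩ := hU (s, t) ⟨hs, ht⟩
    exact h.coneFrame hn (hαt s hs) (hγt t ht) (hα0 s hs) (hLe t ht)
  set k := warpFactor n α s₀ with hk
  -- Frames of `γ` at the single point `t₀` arise from every height `s`; uniqueness of the factor
  -- makes them agree.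
  have hkc : ∀ s ∈ I, warpFactor n α s = k := fun s hs => by
    obtain ⟨η, h⟩ := hframe s hs t₀ ht₀
    obtain ⟨η', h'⟩ := hframe s₀ hs₀ t₀ ht₀
    exact h.factor_unique hdim (hpos t₀ ht₀) (hγnd t₀ ht₀) (hγ1 t₀ ht₀) (hLe t₀ ht₀) h'
  obtain ⟨u, hu⟩ := exists_constant_vector hdim hW hW' hγ hL hpos (hframe s₀ hs₀)
  obtain ⟨c, τ, hc, hτ, hcτ⟩ := exists_normalization k
  have huγ : ∀ t ∈ W, mink (γ t) u = -1 := fun t ht => by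
    have := (hu t ht).pairing
    rwa [mink_add_left, mink_smul_left, (hL t ht).1, mul_zero, add_zero, mink_comm] at this
  have huu : mink u u = 2 * k := by
    have := (hu t₀ ht₀).null
    simp only [mink_add_left, mink_add_right, mink_smul_left, mink_smul_right, huγ t₀ ht₀,
      mink_comm u (γ t₀), (hL t₀ ht₀).1] at this
    linarith
  -- The sign turns `⟨γ, u⟩ = -1` into `⟨γ, a⟩ = τ > 0`.
  refine ⟨-(τ • u), c, τ, fun h0 => ?_, ?_, hc, hτ, ⟨hγ, hpos⟩, fun t ht => ⟨hL t ht, ?_⟩,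
    isTotallyUmbilicalOn_of_coneFrame (by omega) hW hγ hL hγnd hu, fun s hs => ?_⟩
  · have hu0 : u = 0 := by simpa [hτ.ne'] using h0
    have := huγ t₀ ht₀
    rw [hu0, mink_zero_right] at this
    norm_num at this
  · rw [mink_neg_left, mink_neg_right, mink_smul_left, mink_smul_right, huu, hcτ]; ring
  · rw [mink_neg_right, mink_smul_right, huγ t ht]; ring
  · have hn2 : (2 : ℝ) < n := by exact_mod_cast hn
    have hn1 : (n : ℝ) - 1 ≠ 0 := by linarith
    rw [hcτ, ← hkc s hs, warpFactor]
    field_simp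
    ring

end Conclusion

/-! ### Partial diffeomorphisms and charts -/

section InverseFunction

variable {E E' : Type*} [NormedAddCommGroup E] [NormedSpace ℝ E] [NormedAddCommGroup E']
  [NormedSpace ℝ E']

/-- The inverse function theorem, on a neighbourhood. -/
lemma exists_partialDiffeomorph_of_fderiv [CompleteSpace E] {G : E → E'} {U : Set E} {x₀ : E}
    (hU : IsOpen U) (hx₀ : x₀ ∈ U) (hG : ContDiffOn ℝ ∞ G U) (L : E ≃L[ℝ] E')
    (hL : fderiv ℝ G x₀ = L) :
    ∃ Φ : PartialDiffeomorph 𝓘(ℝ, E) 𝓘(ℝ, E') E E' ∞,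
      x₀ ∈ Φ.source ∧ Φ.source ⊆ U ∧ ∀ x, Φ x = G x := by
  have hGa : ∀ x ∈ U, ContDiffAt ℝ ∞ G x := fun x hx => hG.contDiffAt (hU.mem_nhds hx)
  have hd : HasFDerivAt G (L : E →L[ℝ] E') x₀ := by
    rw [← hL]; exact ((hGa x₀ hx₀).differentiableAt (by simp)).hasFDerivAt
  let h := (hGa x₀ hx₀).toOpenPartialHomeomorph G hd (by simp)
  have hcoe : ∀ x, h x = G x := fun x => rfl
  -- Restricting to points with invertible derivative makes the inverse smooth on its whole domain,
  -- not just at the image of `x₀`.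
  let O := U ∩ fderiv ℝ G ⁻¹' Set.range ((↑) : (E ≃L[ℝ] E') → E →L[ℝ] E')
  have hO : IsOpen O :=
    (hG.continuousOn_fderiv_of_isOpen hU (by simp)).isOpen_inter_preimage hU
      ContinuousLinearEquiv.isOpen
  have hx₀O : x₀ ∈ O := ⟨hx₀, L, hL.symm⟩
  let h' := h.restrOpen O hO
  have hs : h'.source = h.source ∩ O := rfl
  refine ⟨⟨h'.toPartialEquiv, h'.open_source, h'.open_target, ?_, ?_⟩, ?_, ?_, fun x => rfl⟩
  · rw [contMDiffOn_iff_contDiffOn]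
    exact hG.mono fun x hx => hx.2.1
  · rw [contMDiffOn_iff_contDiffOn]
    intro y hy
    have hx : h'.symm y ∈ O := (h'.map_target hy).2
    obtain ⟨L', hL'⟩ := hx.2
    refine (h'.contDiffAt_symm (f₀' := L') hy ?_ (hGa _ hx.1)).contDiffWithinAt
    rw [hL']
    exact ((hGa _ hx.1).differentiableAt (by simp)).hasFDerivAt
  · exact ⟨(hGa x₀ hx₀).mem_toOpenPartialHomeomorph_source hd (by simp), hx₀O⟩
  · exact fun x hx => hx.2.1

/-- The identity of an open set as a partial diffeomorphism. -/
def partialDiffeomorphOfSet {O : Set E} (hO : IsOpen O) :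
    PartialDiffeomorph 𝓘(ℝ, E) 𝓘(ℝ, E) E E ∞ where
  toPartialEquiv := PartialEquiv.ofSet O
  open_source := hO
  open_target := hO
  contMDiffOn_toFun := contMDiffOn_id
  contMDiffOn_invFun := contMDiffOn_id

/-- Two linear maps `f : E → ℝ` and `A : E → X` that are jointly injective yield linear coordinates
`(f, L ∘ A)` for some `L : X → V`. -/
lemma exists_coordinates {X V : Type*} [NormedAddCommGroup X] [NormedSpace ℝ X]
    [NormedAddCommGroup V] [NormedSpace ℝ V] [FiniteDimensional ℝ E] [FiniteDimensional ℝ X]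
    [FiniteDimensional ℝ V]
    (hdim : Module.finrank ℝ V + 1 = Module.finrank ℝ E) (f : E →L[ℝ] ℝ) (A : E →L[ℝ] X)
    (hf : ∃ T, f T = 1) (h : ∀ x, f x = 0 → A x = 0 → x = 0) :
    ∃ (L : X →L[ℝ] V) (Ψ : E ≃L[ℝ] ℝ × V), (Ψ : E →L[ℝ] ℝ × V) = f.prod (L ∘L A) := by
  let K := LinearMap.ker f.toLinearMap
  have hK : Module.finrank ℝ K = Module.finrank ℝ V := by
    have h1 := LinearMap.finrank_range_add_finrank_ker f.toLinearMap
    have h2 : LinearMap.range f.toLinearMap = ⊤ := by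
      rw [LinearMap.range_eq_top]
      obtain ⟨T, hT⟩ := hf
      exact fun r => ⟨r • T, by simp [hT]⟩
    rw [h2, finrank_top, Module.finrank_self] at h1
    show Module.finrank ℝ (LinearMap.ker f.toLinearMap) = _
    omega
  let κ : K ≃ₗ[ℝ] V := LinearEquiv.ofFinrankEq _ _ hK
  -- `A` is injective on the kernel of `f`; a left inverse there, followed by an isomorphism of that
  -- kernel with `V`, supplies the remaining coordinates.
  obtain ⟨L₀, hL₀⟩ := LinearMap.exists_leftInverse_of_injective (A.toLinearMap ∘ₗ K.subtype) (by
    rw [LinearMap.ker_eq_bot']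
    rintro ⟨x, hx⟩ h0
    exact Subtype.ext (h x hx h0))
  let L : X →L[ℝ] V := (κ.toLinearMap ∘ₗ L₀).toContinuousLinearMap
  have hinj : Function.Injective (f.prod (L ∘L A)).toLinearMap := by
    rw [injective_iff_map_eq_zero]
    intro x hx
    have h1 : f x = 0 := congrArg Prod.fst hx
    have h2 : κ (L₀ (A x)) = 0 := congrArg Prod.snd hx
    have h3 : L₀ (A x) = ⟨x, h1⟩ := congrArg (fun B => B (⟨x, h1⟩ : K)) hL₀
    rw [h3, map_eq_zero_iff κ κ.injective] at h2
    exact congrArg Subtype.val h2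
  refine ⟨L, (LinearEquiv.ofInjectiveOfFinrankEq _ hinj ?_).toContinuousLinearEquiv, ?_⟩
  · rw [Module.finrank_prod, Module.finrank_self]; omega
  · ext1 x; rfl

end InverseFunction

section Charts

variable {n m : ℕ} {M : Type*} [TopologicalSpace M] [ChartedSpace (EuclideanSpace ℝ (Fin n)) M]

lemma contDiffOn_comp_symm {E' : Type*} [NormedAddCommGroup E']
    [NormedSpace ℝ E'] {φ : M → (Fin (m + 1) → ℝ)}
    (hφ : ContMDiff (𝓡 n) 𝓘(ℝ, Fin (m + 1) → ℝ) ∞ φ)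
    (e : PartialDiffeomorph (𝓡 n) 𝓘(ℝ, E') M E' ∞) :
    ContDiffOn ℝ ∞ (fun y => φ (e.symm y)) e.target := by
  rw [← contMDiffOn_iff_contDiffOn]
  exact hφ.comp_contMDiffOn e.contMDiffOn_invFun

variable [IsManifold (𝓡 n) ∞ M]

variable (M) in
/-- The chart at `p` as a partial diffeomorphism. -/
noncomputable def chartDiffeomorph (p : M) :
    PartialDiffeomorph (𝓡 n) 𝓘(ℝ, EuclideanSpace ℝ (Fin n)) M (EuclideanSpace ℝ (Fin n)) ∞ where
  toPartialEquiv := extChartAt (𝓡 n) p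
  open_source := isOpen_extChartAt_source p
  open_target := isOpen_extChartAt_target p
  contMDiffOn_toFun := by
    rw [extChartAt_source]; exact contMDiffOn_extChartAt
  contMDiffOn_invFun := contMDiffOn_extChartAt_symm p

variable {E' : Type*} [NormedAddCommGroup E'] [NormedSpace ℝ E']

lemma bijective_fderiv_of_inverse {E : Type*} [NormedAddCommGroup E] [NormedSpace ℝ E]
    {G : E' → E} {G' : E → E'} {y : E'} {x : E} (hxy : G y = x) (hyx : G' x = y)
    (hG : DifferentiableAt ℝ G y) (hG' : DifferentiableAt ℝ G' x)
    (h : G' ∘ G =ᶠ[𝓝 y] id) (h' : G ∘ G' =ᶠ[𝓝 x] id) : Function.Bijective (fderiv ℝ G y) := by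
  subst hxy
  have h1 : fderiv ℝ G' (G y) ∘L fderiv ℝ G y = ContinuousLinearMap.id ℝ E' := by
    rw [← fderiv_comp y hG' hG, h.fderiv_eq, fderiv_id]
  have h2 : fderiv ℝ G y ∘L fderiv ℝ G' (G y) = ContinuousLinearMap.id ℝ E := by
    have := fderiv_comp (G y) (g := G) (f := G') (by rw [hyx]; exact hG) hG'
    rw [hyx] at this
    rw [← this, h'.fderiv_eq, fderiv_id]
  exact Function.bijective_iff_has_inverse.2 ⟨fderiv ℝ G' (G y),
    fun v => congrArg (fun L => L v) h1, fun v => congrArg (fun L => L v) h2⟩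

/-- Local coordinates and the chart at a point of their domain differ by a smooth coordinate
change. -/
lemma exists_transition (e : PartialDiffeomorph (𝓡 n) 𝓘(ℝ, E') M E' ∞) {q : M} (hq : q ∈ e.source) :
    ∃ (G : E' → EuclideanSpace ℝ (Fin n)) (G' : EuclideanSpace ℝ (Fin n) → E'),
      G (e q) = extChartAt (𝓡 n) q q ∧ G' (extChartAt (𝓡 n) q q) = e q ∧
      ContDiffAt ℝ ∞ G (e q) ∧ ContDiffAt ℝ ∞ G' (extChartAt (𝓡 n) q q) ∧
      Function.Bijective (fderiv ℝ G (e q)) ∧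
      ∀ φ : M → (Fin (m + 1) → ℝ), (fun y => φ (e.symm y)) =ᶠ[𝓝 (e q)] inChart q φ ∘ G ∧
        inChart q φ =ᶠ[𝓝 (extChartAt (𝓡 n) q q)] (fun y => φ (e.symm y)) ∘ G' := by
  let Φ := (chartDiffeomorph (n := n) M q).symm.trans e
  have hqc : q ∈ (chartDiffeomorph (n := n) M q).source := mem_extChartAt_source q
  set x := extChartAt (𝓡 n) q q with hx
  have hxq : (chartDiffeomorph (n := n) M q).symm x = q := extChartAt_to_inv q
  have hΦx : Φ x = e q := congrArg e hxq
  have hxs : x ∈ Φ.source := by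
    refine ⟨mem_extChartAt_target q, ?_⟩
    show (chartDiffeomorph (n := n) M q).symm x ∈ e.source
    rw [hxq]; exact hq
  have hyt : e q ∈ Φ.target := hΦx ▸ Φ.map_source hxs
  have hΦy : Φ.symm (e q) = x := by
    rw [← hΦx]; exact Φ.left_inv hxs
  have hG : ContDiffAt ℝ ∞ Φ.symm (e q) :=
    (contMDiffOn_iff_contDiffOn.1 Φ.contMDiffOn_invFun).contDiffAt (Φ.open_target.mem_nhds hyt)
  have hG' : ContDiffAt ℝ ∞ Φ x :=
    (contMDiffOn_iff_contDiffOn.1 Φ.contMDiffOn_toFun).contDiffAt (Φ.open_source.mem_nhds hxs)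
  refine ⟨Φ.symm, Φ, hΦy, hΦx, hG, hG', ?_, fun φ => ⟨?_, ?_⟩⟩
  · refine bijective_fderiv_of_inverse hΦy hΦx (hG.differentiableAt (by simp))
      (hG'.differentiableAt (by simp)) ?_ ?_
    · exact Filter.mem_of_superset (Φ.open_target.mem_nhds hyt) fun y hy => Φ.right_inv hy
    · exact Filter.mem_of_superset (Φ.open_source.mem_nhds hxs) fun y hy => Φ.left_inv hy
  · refine Filter.mem_of_superset (Φ.open_target.mem_nhds hyt) fun y hy => ?_
    exact congrArg φ ((chartDiffeomorph (n := n) M q).left_inv hy.2).symm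
  · refine Filter.mem_of_superset (Φ.open_source.mem_nhds hxs) fun y hy => ?_
    exact congrArg φ (e.left_inv hy.2).symm

variable {φ : M → (Fin (m + 1) → ℝ)}

lemma contDiffOn_inChart (hφ : ContMDiff (𝓡 n) 𝓘(ℝ, Fin (m + 1) → ℝ) ∞ φ) (p : M) :
    ContDiffOn ℝ ∞ (inChart p φ) (extChartAt (𝓡 n) p).target := by
  rw [← contMDiffOn_iff_contDiffOn]
  exact hφ.comp_contMDiffOn (contMDiffOn_extChartAt_symm p)

lemma contDiffAt_inChart (hφ : ContMDiff (𝓡 n) 𝓘(ℝ, Fin (m + 1) → ℝ) ∞ φ) (p : M) :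
    ContDiffAt ℝ ∞ (inChart p φ) (extChartAt (𝓡 n) p p) :=
  (contDiffOn_inChart hφ p).contDiffAt
    ((isOpen_extChartAt_target p).mem_nhds (mem_extChartAt_target p))

end Charts

/-! ### Adapted coordinates -/

section Adapted

variable {n : ℕ} {E V : Type*} [NormedAddCommGroup E] [NormedSpace ℝ E] [NormedAddCommGroup V]
  [NormedSpace ℝ V]

/-- The projection of the light-like hypercylinder to the section `x₁ = 1` of the light cone. -/
noncomputable def coneDirection (x : Fin (n + 2) → ℝ) : Fin (n + 1) → ℝ :=
  (x 0)⁻¹ • Fin.init x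

lemma differentiableAt_coneDirection_and_init_fderiv {F : E → (Fin (n + 2) → ℝ)} {x : E} (hF : DifferentiableAt ℝ F x)
    (h0 : F x 0 ≠ 0) :
    DifferentiableAt ℝ (fun y => coneDirection (F y)) x ∧
      ∀ X, (Fin.init (fderiv ℝ F x X) : Fin (n + 1) → ℝ) =
        F x 0 • fderiv ℝ (fun y => coneDirection (F y)) x X
          + fderiv ℝ F x X 0 • coneDirection (F x) := by
  have h1 : DifferentiableAt ℝ (fun y => F y 0) x := differentiableAt_pi.1 hF 0
  have hinit : HasFDerivAt (fun y => (Fin.init (F y) : Fin (n + 1) → ℝ))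
      (initCLM n ∘L fderiv ℝ F x) x := (initCLM n).hasFDerivAt.comp x hF.hasFDerivAt
  have hd : DifferentiableAt ℝ (fun y => coneDirection (F y)) x :=
    (h1.inv h0).smul hinit.differentiableAt
  refine ⟨hd, fun X => ?_⟩
  have hev : (fun y => (Fin.init (F y) : Fin (n + 1) → ℝ)) =ᶠ[𝓝 x]
      fun y => F y 0 • coneDirection (F y) := by
    filter_upwards [h1.continuousAt.eventually_ne h0] with y hy
    rw [coneDirection, smul_inv_smul₀ hy]
  have h2 : HasFDerivAt (fun y => F y 0 • coneDirection (F y)) _ x :=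
    h1.hasFDerivAt.smul hd.hasFDerivAt
  have h3 := congrArg (fun L => L X) (hinit.unique (h2.congr_of_eventuallyEq hev))
  have h4 : fderiv ℝ (fun y => F y 0) x X = fderiv ℝ F x X 0 := by
    rw [(hasFDerivAt_coord hF 0).fderiv]; rfl
  simpa [h4] using h3

lemma fderiv_eq_smul_dropLast {F : E → (Fin (n + 2) → ℝ)} {x X : E} (hF : DifferentiableAt ℝ F x)
    (h0 : F x 0 ≠ 0) (hlast : fderiv ℝ F x X (Fin.last _) = 0)
    (hdir : fderiv ℝ (fun y => coneDirection (F y)) x X = 0) :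
    ∃ z : ℝ, fderiv ℝ F x X = z • dropLast n (F x) := by
  refine ⟨fderiv ℝ F x X 0 * (F x 0)⁻¹, ?_⟩
  have h1 := (differentiableAt_coneDirection_and_init_fderiv hF h0).2 X
  rw [hdir, smul_zero, zero_add, coneDirection, smul_smul] at h1
  have h2 : fderiv ℝ F x X = pairLast ((fderiv ℝ F x X 0 * (F x 0)⁻¹) • Fin.init (F x)) 0 := by
    rw [← h1, ← hlast, pairLast_init_last]
  have h3 := (pairLastCLM n).map_smul (fderiv ℝ F x X 0 * (F x 0)⁻¹) (Fin.init (F x), (0 : ℝ))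
  rw [pairLastCLM_apply, pairLastCLM_apply, Prod.smul_fst, Prod.smul_snd, smul_zero] at h3
  exact h2.trans h3

/-- Along the gradient of `s`, the cone component moves radially, so its direction is stationary. -/
lemma fderiv_coneDirection_height_gradient {F : E → (Fin (n + 2) → ℝ)} {x T : E} {z : ℝ}
    (hF : DifferentiableAt ℝ F x) (h0 : F x 0 ≠ 0)
    (hT : fderiv ℝ F x T = lastVec n + z • dropLast n (F x)) :
    fderiv ℝ (fun y => coneDirection (F y)) x T = 0 := by
  have h1 := (differentiableAt_coneDirection_and_init_fderiv hF h0).2 T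
  have h2 : fderiv ℝ F x T 0 = z * F x 0 := by
    rw [hT]; exact congrFun (init_height_gradient (F x) z) 0
  rw [h2, hT, init_height_gradient, coneDirection, smul_smul, mul_assoc, mul_inv_cancel₀ h0,
    mul_one] at h1
  have h3 := left_eq_add.1 (h1.trans (add_comm _ _))
  exact (smul_eq_zero.1 h3).resolve_left h0

lemma contDiffAt_coneDirection {F : E → (Fin (n + 2) → ℝ)} {x : E} (hF : ContDiffAt ℝ ∞ F x)
    (h0 : F x 0 ≠ 0) : ContDiffAt ℝ ∞ (fun y => coneDirection (F y)) x :=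
  ((contDiffAt_pi.1 hF 0).inv h0).smul ((initCLM n).contDiff.contDiffAt.comp x hF)

/-- The height function and linear functions of the direction in the light cone form local
coordinates. -/
lemma exists_adapted_partialDiffeomorph [FiniteDimensional ℝ V] (hdim : Module.finrank ℝ V + 1 = n)
    {F : EuclideanSpace ℝ (Fin n) → (Fin (n + 2) → ℝ)} {U : Set (EuclideanSpace ℝ (Fin n))}
    {x₀ : EuclideanSpace ℝ (Fin n)} (hU : IsOpen U) (hx₀ : x₀ ∈ U) (hF : ContDiffOn ℝ ∞ F U)
    (hL : ∀ x, F x ∈ lightCylinder n) (hnd : NondegenerateAt F x₀) :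
    ∃ (Φ : PartialDiffeomorph 𝓘(ℝ, EuclideanSpace ℝ (Fin n)) 𝓘(ℝ, ℝ × V)
        (EuclideanSpace ℝ (Fin n)) (ℝ × V) ∞) (L : (Fin (n + 1) → ℝ) →L[ℝ] V),
      x₀ ∈ Φ.source ∧ Φ.source ⊆ U ∧
        ∀ x, Φ x = (F x (Fin.last _), L (coneDirection (F x))) := by
  have hFa : ∀ x ∈ U, ContDiffAt ℝ ∞ F x := fun x hx => hF.contDiffAt (hU.mem_nhds hx)
  have h0 : ∀ x, F x 0 ≠ 0 := fun x => (hL x).2.ne'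
  have hd : DifferentiableAt ℝ F x₀ := (hFa x₀ hx₀).differentiableAt (by simp)
  have hLe : ∀ᶠ y in 𝓝 x₀, F y ∈ lightCylinder n := Filter.Eventually.of_forall hL
  obtain ⟨ξ, hξ, hξξ, hξθ⟩ := exists_null_normal hd hLe hnd
  obtain ⟨T, z, hT⟩ := exists_height_gradient (by simp) hd hLe hnd hξ hξθ
  have hc := differentiableAt_coneDirection_and_init_fderiv hd (h0 x₀)
  -- A vector killed by the differentials of height and direction maps to a multiple of `θ`, hence
  -- is orthogonal to every tangent vector and vanishes by non-degeneracy.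
  obtain ⟨L, Ψ, hΨ⟩ := exists_coordinates (V := V) (by simpa using hdim)
    (coordCLM n (Fin.last (n + 1)) ∘L fderiv ℝ F x₀)
    (fderiv ℝ (fun y => coneDirection (F y)) x₀) ⟨T, last_height_gradient hT⟩ fun X h1 h2 => by
      obtain ⟨w, hw⟩ := fderiv_eq_smul_dropLast hd (h0 x₀) h1 h2
      refine hnd X fun Y => ?_
      rw [hw, mink_smul_left, theta_normal hd hLe, mul_zero]
  obtain ⟨Φ, h1, h2, h3⟩ := exists_partialDiffeomorph_of_fderiv
    (G := fun x => (F x (Fin.last _), L (coneDirection (F x)))) hU hx₀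
    (fun x hx => ((contDiffAt_pi.1 (hFa x hx) _).prodMk (L.contDiff.contDiffAt.comp x
      (contDiffAt_coneDirection (hFa x hx) (h0 x)))).contDiffWithinAt) Ψ (by
      have e1 := hasFDerivAt_coord hd (Fin.last (n + 1))
      have e2 := L.hasFDerivAt.comp x₀ hc.1.hasFDerivAt
      rw [hΨ]
      exact (e1.prodMk e2).fderiv)
  exact ⟨Φ, L, h1, h2, h3⟩

/-- In these coordinates the gradient of `s` is `(1, 0)`: its height component is `1` and its
direction component is `0`. -/
lemma exists_fderiv_fst [FiniteDimensional ℝ V] (hdim : Module.finrank ℝ V + 1 = n)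
    {F : ℝ × V → (Fin (n + 2) → ℝ)} {y : ℝ × V} {L : (Fin (n + 1) → ℝ) →L[ℝ] V}
    (hF : DifferentiableAt ℝ F y) (hL : ∀ᶠ y in 𝓝 y, F y ∈ lightCylinder n)
    (hnd : NondegenerateAt F y) (hU : ∃ ξ b, UmbilicalFrame F y ξ b)
    (hy : ∀ᶠ y in 𝓝 y, (F y (Fin.last _), L (coneDirection (F y))) = y) :
    ∃ z : ℝ, fderiv ℝ F y (1, 0) = lastVec n + z • dropLast n (F y) := by
  obtain ⟨ξ, b, h⟩ := hU
  have h0 : F y 0 ≠ 0 := hL.self_of_nhds.2.ne'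
  obtain ⟨T, z, hT⟩ := exists_height_gradient (by simp [← hdim, add_comm]) hF hL hnd h.normal
    h.pairing
  have h1 : T.1 = 1 := by
    rw [← fderiv_last hF (hy.mono fun y hy => congrArg Prod.fst hy) T, last_height_gradient hT]
  have h2 : T.2 = 0 := by
    have e1 := L.hasFDerivAt.comp y (differentiableAt_coneDirection_and_init_fderiv hF h0).1.hasFDerivAt
    have e2 := e1.unique ((hasFDerivAt_snd (𝕜 := ℝ) (p := y)).congr_of_eventuallyEq
      (hy.mono fun y hy => congrArg Prod.snd hy))
    have e3 := congrArg (fun B => B T) e2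
    simp only [ContinuousLinearMap.comp_apply, fderiv_coneDirection_height_gradient hF h0 hT,
      map_zero] at e3
    exact e3.symm
  have hT' : T = (1, 0) := Prod.ext h1 h2
  exact ⟨z, hT' ▸ hT⟩

end Adapted

/-! ### Sections of the light cone by hyperplanes -/

/-- As `⟨γ, a⟩` is constant, `a` is normal and pairs to zero with second derivatives, so only the
`γ` part of `η` contributes to umbilicity; its coefficient makes `η` light-like. -/
lemma coneFrame_of_sigmaSet {m : ℕ} {V : Type*} [NormedAddCommGroup V] [NormedSpace ℝ V]
    {γ : V → (Fin (m + 1) → ℝ)} {t : V} {a : Fin (m + 1) → ℝ} {τ : ℝ} (hτ : 0 < τ)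
    (hγ : ContDiffAt ℝ 2 γ t) (h : ∀ᶠ y in 𝓝 t, γ y ∈ sigmaSet a τ) :
    ConeFrame γ t ((mink a a / (2 * τ ^ 2)) • γ t - τ⁻¹ • a) (mink a a / (2 * τ ^ 2)) := by
  have hL : ∀ᶠ y in 𝓝 t, γ y ∈ lightCone m := h.mono fun y hy => hy.1
  have hγ1 := hγ.differentiableAt (by norm_num)
  have hγγ : mink (γ t) (γ t) = 0 := hL.self_of_nhds.1
  have hγa : mink (γ t) a = τ := h.self_of_nhds.2
  have haγ : mink a (γ t) = τ := by rw [mink_comm, hγa]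
  have hn : ∀ᶠ y in 𝓝 t, ∀ v, mink a (fderiv ℝ γ y v) = 0 := by
    filter_upwards [h.eventually_nhds, hγ.eventually (by simp)] with y hy hy' v
    have := mink_fderiv_add (differentiableAt_const a) (hy'.differentiableAt (by norm_num))
      (hy.mono fun z hz => (mink_comm _ _).trans hz.2) v
    simpa using this
  have hs : ∀ v w, mink (fderiv ℝ (fderiv ℝ γ) t v w) a = 0 := fun v w => by
    have := mink_second_add hγ (differentiableAt_const a) (hn.mono fun y hy => hy w) v
    simpa using this
  refine ⟨fun v => ?_, ?_, ?_, fun v w => ?_⟩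
  · rw [mink_sub_left, mink_smul_left, mink_smul_left, cone_normal hγ1 hL, hn.self_of_nhds]
    ring
  · simp only [mink_sub_left, mink_sub_right, mink_smul_left, mink_smul_right, hγγ, hγa, haγ]
    field_simp
    ring
  · simp only [mink_sub_left, mink_smul_left, hγγ, haγ]
    field_simp
    ring
  · rw [mink_sub_right, mink_smul_right, mink_smul_right, hs, cone_second hγ hL]
    ring

/-! ### The characterization of pseudo-umbilical submanifolds -/

section Main

variable {n : ℕ} {M : Type*} [TopologicalSpace M] [ChartedSpace (EuclideanSpace ℝ (Fin n)) M]
  {φ : M → (Fin (n + 2) → ℝ)}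

lemma NondegenerateAt.exists_inducedMetric_ne_zero (hn : 0 < n)
    {F : EuclideanSpace ℝ (Fin n) → (Fin (n + 2) → ℝ)} {x : EuclideanSpace ℝ (Fin n)}
    (h : NondegenerateAt F x) : ∃ X Y, inducedMetric F x X Y ≠ 0 := by
  by_contra! hc
  have : Nontrivial (EuclideanSpace ℝ (Fin n)) :=
    Module.nontrivial_of_finrank_pos (R := ℝ) (by simpa using hn)
  obtain ⟨X, hX⟩ := exists_ne (0 : EuclideanSpace ℝ (Fin n))
  exact hX (h X (hc X))

/-- Pseudo-umbilicity can be checked with locally smooth factors. -/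
lemma isPseudoUmbilical_of_local (hn : 0 < n) (hφ : IsNondegenerateSubmanifold (n := n) φ)
    (h : ∀ p : M, ∃ g : M → ℝ, ContMDiffAt (𝓡 n) 𝓘(ℝ, ℝ) ∞ g p ∧ ∀ᶠ q in 𝓝 p, ∀ X Y,
      shapeForm (inChart q φ) (extChartAt (𝓡 n) q q) (meanCurvatureField (n := n) φ q) X Y =
        g q * inducedMetric (inChart q φ) (extChartAt (𝓡 n) q q) X Y) :
    IsPseudoUmbilical (n := n) φ := by
  choose g hg hgp using h
  refine ⟨fun q => g q q, fun p => (hg p).congr_of_eventuallyEq ?_, fun p =>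
    (hgp p).self_of_nhds⟩
  -- The induced metric is nonzero, so the factor at `q` is unique and the local factors agree.
  filter_upwards [hgp p] with q hq
  obtain ⟨X, Y, hXY⟩ := NondegenerateAt.exists_inducedMetric_ne_zero hn (hφ.nondegenerate q)
  exact mul_right_cancel₀ hXY (((hgp q).self_of_nhds X Y).symm.trans (hq X Y))

variable [IsManifold (𝓡 n) ∞ M]

lemma IsPseudoUmbilical.exists_umbilicalFrame (h : IsPseudoUmbilical (n := n) φ) (hn : 2 < n)
    (hφ : IsNondegenerateSubmanifold (n := n) φ) (hLC : ∀ p, φ p ∈ lightCylinder n) (q : M) :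
    ∃ ξ b, UmbilicalFrame (inChart q φ) (extChartAt (𝓡 n) q q) ξ b := by
  obtain ⟨f, -, hf⟩ := h
  exact Minkowski.exists_umbilicalFrame hn ((contDiffAt_inChart hφ.smooth q).of_le two_le_infty)
    (Filter.Eventually.of_forall fun x => hLC _) (hφ.nondegenerate q) (hf q)

/-- The chart underlying `inChart q φ` varies with `q`; this transfers the pointwise conditions to
one fixed coordinate system. -/
lemma umbilicalFrame_comp_symm {E' : Type*} [NormedAddCommGroup E'] [NormedSpace ℝ E']
    (hφ : IsNondegenerateSubmanifold (n := n) φ)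
    (e : PartialDiffeomorph (𝓡 n) 𝓘(ℝ, E') M E' ∞) {q : M} (hq : q ∈ e.source) :
    NondegenerateAt (fun y => φ (e.symm y)) (e q) ∧
    ∀ ξ b, UmbilicalFrame (inChart q φ) (extChartAt (𝓡 n) q q) ξ b ↔
      UmbilicalFrame (fun y => φ (e.symm y)) (e q) ξ b := by
  obtain ⟨G, G', hGe, hGe', hG, hG', hbij, hcomp⟩ := exists_transition (m := n + 1) e hq
  obtain ⟨h1, h2⟩ := hcomp φ
  have hF := contDiffAt_inChart hφ.smooth q
  have hF' : ContDiffAt ℝ ∞ (fun y => φ (e.symm y)) (e q) :=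
    (contDiffOn_comp_symm hφ.smooth e).contDiffAt (e.open_target.mem_nhds (e.map_source hq))
  refine ⟨?_, fun ξ b => ⟨fun h => ?_, fun h => ?_⟩⟩
  · have hnd : NondegenerateAt (inChart q φ) (G (e q)) := by
      rw [hGe]; exact hφ.nondegenerate q
    refine (hnd.comp ?_ (hG.differentiableAt (by simp)) hbij).congr h1
    rw [hGe]; exact hF.differentiableAt (by simp)
  · rw [← hGe] at h hF
    exact (h.comp (hF.of_le two_le_infty) (hG.of_le two_le_infty)).congr h1
  · rw [← hGe'] at h hF'
    exact (h.comp (hF'.of_le two_le_infty) (hG'.of_le two_le_infty)).congr h2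

/-- Adapted coordinates over a box around a point. -/
lemma exists_adapted_coordinates {V : Type*} [NormedAddCommGroup V] [NormedSpace ℝ V]
    [FiniteDimensional ℝ V] (hdim : Module.finrank ℝ V + 1 = n)
    (hφ : IsNondegenerateSubmanifold (n := n) φ) (hLC : ∀ p, φ p ∈ lightCylinder n) (p : M) :
    ∃ (I : Set ℝ) (W : Set V) (e : PartialDiffeomorph (𝓡 n) 𝓘(ℝ, ℝ × V) M (ℝ × V) ∞)
      (L : (Fin (n + 1) → ℝ) →L[ℝ] V), IsOpen I ∧ Convex ℝ I ∧ I.Nonempty ∧ IsOpen W ∧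
      Convex ℝ W ∧ W.Nonempty ∧ p ∈ e.source ∧ e.target = I ×ˢ W ∧
      ∀ y ∈ e.target, (φ (e.symm y) (Fin.last _), L (coneDirection (φ (e.symm y)))) = y := by
  obtain ⟨Φ, L, hx₀, -, hΦ⟩ := exists_adapted_partialDiffeomorph (V := V) hdim
    (isOpen_extChartAt_target (I := 𝓡 n) p) (mem_extChartAt_target p) (contDiffOn_inChart hφ.smooth p)
    (fun x => hLC _) (hφ.nondegenerate p)
  let e₁ := (chartDiffeomorph (n := n) M p).trans Φ
  have hp₁ : p ∈ e₁.source := ⟨mem_extChartAt_source p, hx₀⟩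
  -- A ball of the sup metric on `ℝ × V` is a product of balls, so shrinking to one gives a box with
  -- convex factors.
  obtain ⟨r, hr, hball⟩ := Metric.isOpen_iff.1 e₁.open_target (e₁ p) (e₁.map_source hp₁)
  let e := e₁.trans (partialDiffeomorphOfSet (Metric.isOpen_ball (x := e₁ p) (ε := r)))
  have ht : e.target = Metric.ball (e₁ p) r :=
    Set.inter_eq_left.2 fun y hy => hball hy
  refine ⟨Metric.ball (e₁ p).1 r, Metric.ball (e₁ p).2 r, e, L, Metric.isOpen_ball, convex_ball _ _,
    ⟨_, Metric.mem_ball_self hr⟩, Metric.isOpen_ball, convex_ball _ _,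
    ⟨_, Metric.mem_ball_self hr⟩, ⟨hp₁, Metric.mem_ball_self hr⟩, ?_, fun y hy => ?_⟩
  · rw [ht, ball_prod_same]
  · rw [ht] at hy
    have h1 := Φ.right_inv (hball hy).1
    exact (hΦ _).symm.trans h1

lemma IsPseudoUmbilical.exists_warped_coordinates (h : IsPseudoUmbilical (n := n) φ) (hn : 2 < n)
    (hφ : IsNondegenerateSubmanifold (n := n) φ) (hLC : ∀ p, φ p ∈ lightCylinder n) (p : M) :
    ∃ (I : Set ℝ) (W : Set (EuclideanSpace ℝ (Fin (n - 1))))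
      (αhat : ℝ → ℝ) (γ : EuclideanSpace ℝ (Fin (n - 1)) → (Fin (n + 1) → ℝ))
      (a : Fin (n + 1) → ℝ) (c τ : ℝ)
      (e : PartialDiffeomorph (𝓡 n) 𝓘(ℝ, ℝ × EuclideanSpace ℝ (Fin (n - 1)))
        M (ℝ × EuclideanSpace ℝ (Fin (n - 1))) ∞),
      IsOpen I ∧ I.OrdConnected ∧ IsOpen W ∧ p ∈ e.source ∧ e.target = I ×ˢ W ∧
      ContDiffOn ℝ ∞ αhat I ∧ (∀ s ∈ I, αhat s ≠ 0) ∧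
      (∀ s ∈ I, ∀ t ∈ W, φ (e.symm (s, t)) = pairLast (αhat s • γ t) s) ∧
      a ≠ 0 ∧ mink a a = c ∧ (c = 1 ∨ c = -1 ∨ c = 0) ∧ 0 < τ ∧
      IsSpacelikeOn γ W ∧ (∀ t ∈ W, γ t ∈ sigmaSet a τ) ∧ IsTotallyUmbilicalOn γ W ∧
      ∀ s ∈ I, ((n : ℝ) - 2) * τ ^ 2 * αhat s * deriv (deriv αhat) s
        - ((n : ℝ) - 1) * (c + τ ^ 2 * (deriv αhat s) ^ 2) = 0 := by
  have hdim : Module.finrank ℝ (EuclideanSpace ℝ (Fin (n - 1))) + 1 = n := by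
    rw [finrank_euclideanSpace_fin]; omega
  obtain ⟨I, W, e, L, hI, hI', hIne, hW, hW', hWne, hp, ht, he⟩ :=
    exists_adapted_coordinates hdim hφ hLC p
  set F : ℝ × EuclideanSpace ℝ (Fin (n - 1)) → (Fin (n + 2) → ℝ) := fun y => φ (e.symm y) with hF
  have hFs : ContDiffOn ℝ ∞ F (I ×ˢ W) := ht ▸ contDiffOn_comp_symm hφ.smooth e
  have hO : ∀ y ∈ I ×ˢ W, I ×ˢ W ∈ 𝓝 y := fun y hy => (hI.prod hW).mem_nhds hy
  have hpt : ∀ y ∈ I ×ˢ W, NondegenerateAt F y ∧ ∃ ξ b, UmbilicalFrame F y ξ b := fun y hy => by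
    rw [← ht] at hy
    have hq : e.symm y ∈ e.source := e.map_target hy
    have hey : e (e.symm y) = y := e.right_inv hy
    obtain ⟨h1, h2⟩ := umbilicalFrame_comp_symm hφ e hq
    obtain ⟨ξ, b, h3⟩ := h.exists_umbilicalFrame hn hφ hLC (e.symm y)
    rw [h2] at h3
    rw [hey] at h1 h3
    exact ⟨h1, ξ, b, h3⟩
  have hL : ∀ y ∈ I ×ˢ W, F y ∈ lightCylinder n := fun y _ => hLC _
  have he' : ∀ y ∈ I ×ˢ W, (F y (Fin.last _), L (coneDirection (F y))) = y := ht ▸ he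
  have hT : ∀ y ∈ I ×ˢ W, ∃ z : ℝ, fderiv ℝ F y (1, 0) = lastVec n + z • dropLast n (F y) :=
    fun y hy => exists_fderiv_fst hdim ((hFs.contDiffAt (hO y hy)).differentiableAt (by simp))
      (Filter.Eventually.of_forall fun _ => hLC _) (hpt y hy).1 (hpt y hy).2
      (Filter.mem_of_superset (hO y hy) he')
  obtain ⟨s₀, hs₀⟩ := hIne
  obtain ⟨t₀, ht₀⟩ := hWne
  obtain ⟨α, γ, hα, hα0, hγ, hγL, hFw⟩ := exists_warped hI hI'.isPreconnected hW hW'.isPreconnected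
    hs₀ ht₀ hFs hL (fun y hy => congrArg Prod.fst (he' y hy)) hT fun y hy => (hpt y hy).2
  have hev : ∀ y ∈ I ×ˢ W, warped α γ =ᶠ[𝓝 y] F := fun y hy =>
    Filter.mem_of_superset (hO y hy) fun z hz => (hFw z hz).symm
  obtain ⟨a, c, τ, hrest⟩ := warped_data hn hI ⟨s₀, hs₀⟩ hW hW'.isPreconnected ⟨t₀, ht₀⟩ hα hα0 hγ
    hγL (fun y hy => (hpt y hy).1.congr (hev y hy)) fun y hy => by
      obtain ⟨ξ, b, h3⟩ := (hpt y hy).2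
      exact ⟨ξ, b, h3.congr (hev y hy)⟩
  exact ⟨I, W, α, γ, a, c, τ, e, hI, hI'.ordConnected, hW, hp, ht, hα, hα0,
    fun s hs t ht => hFw (s, t) ⟨hs, ht⟩, hrest⟩

lemma exists_umbilicalFrame_of_warped (hn : 2 < n)
    (hφ : IsNondegenerateSubmanifold (n := n) φ) {V : Type*} [NormedAddCommGroup V]
    [NormedSpace ℝ V] {I : Set ℝ} {W : Set V} {α : ℝ → ℝ} {γ : V → (Fin (n + 1) → ℝ)}
    {a : Fin (n + 1) → ℝ} {τ : ℝ} (e : PartialDiffeomorph (𝓡 n) 𝓘(ℝ, ℝ × V) M (ℝ × V) ∞)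
    (hI : IsOpen I) (hW : IsOpen W) (ht : e.target = I ×ˢ W) (hα : ContDiffOn ℝ ∞ α I)
    (hα0 : ∀ s ∈ I, α s ≠ 0) (hw : ∀ s ∈ I, ∀ t ∈ W, φ (e.symm (s, t)) = pairLast (α s • γ t) s)
    (hτ : 0 < τ) (hγ : ContDiffOn ℝ ∞ γ W) (hγa : ∀ t ∈ W, γ t ∈ sigmaSet a τ)
    (hode : ∀ s ∈ I, ((n : ℝ) - 2) * τ ^ 2 * α s * deriv (deriv α) s
        - ((n : ℝ) - 1) * (mink a a + τ ^ 2 * (deriv α s) ^ 2) = 0) {q : M} (hq : q ∈ e.source) :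
    ∃ ξ, UmbilicalFrame (inChart q φ) (extChartAt (𝓡 n) q q) ξ
      (deriv (deriv α) (e q).1 / (α (e q).1 * (2 * n - 2))) := by
  have hy : e q ∈ I ×ˢ W := ht ▸ e.map_source hq
  obtain ⟨hs, htW⟩ := hy
  have hγt : ContDiffAt ℝ 2 γ (e q).2 := (hγ.contDiffAt (hW.mem_nhds htW)).of_le two_le_infty
  have hγe : ∀ᶠ y in 𝓝 (e q).2, γ y ∈ sigmaSet a τ := Filter.mem_of_superset (hW.mem_nhds htW) hγa
  have hn2 : (2 : ℝ) < n := by exact_mod_cast hn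
  have hn1 : (n : ℝ) - 1 ≠ 0 := by linarith
  obtain ⟨ξ, hξ⟩ := (coneFrame_of_sigmaSet hτ hγt hγe).umbilicalFrame_warped hn
    ((hα.contDiffAt (hI.mem_nhds hs)).of_le two_le_infty) hγt (hα0 _ hs)
    (hγe.mono fun y hy => hy.1) (by
      have := hode _ hs
      rw [warpFactor]
      field_simp
      linear_combination -this)
  refine ⟨ξ, ((umbilicalFrame_comp_symm hφ e hq).2 _ _).2 (hξ.congr ?_)⟩
  exact Filter.mem_of_superset ((hI.prod hW).mem_nhds ⟨hs, htW⟩) fun y hy => hw _ hy.1 _ hy.2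

end Main

end Minkowski

theorem mainTheorem1 {n : ℕ} (hn : 2 < n)
    {M : Type*} [TopologicalSpace M] [ChartedSpace (EuclideanSpace ℝ (Fin n)) M]
    [IsManifold (𝓡 n) ∞ M]
    (φ : M → (Fin (n + 2) → ℝ)) (hφ : IsNondegenerateSubmanifold (n := n) φ)
    (hLC : ∀ p, φ p ∈ lightCylinder n)
    (α : M → ℝ) (hα : IsAlpha φ α) (hα0 : ∀ p, α p ≠ 0) :
    IsPseudoUmbilical (n := n) φ ↔
      ∀ p : M,
        ∃ (I : Set ℝ) (W : Set (EuclideanSpace ℝ (Fin (n - 1))))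
          (αhat : ℝ → ℝ) (γ : EuclideanSpace ℝ (Fin (n - 1)) → (Fin (n + 1) → ℝ))
          (a : Fin (n + 1) → ℝ) (c τ : ℝ)
          (e : PartialDiffeomorph (𝓡 n) 𝓘(ℝ, ℝ × EuclideanSpace ℝ (Fin (n - 1)))
            M (ℝ × EuclideanSpace ℝ (Fin (n - 1))) ∞),
          -- `(s, t) = e` are local coordinates of `M` near `p` with values in `I × W`
          IsOpen I ∧ I.OrdConnected ∧ IsOpen W ∧
          p ∈ e.source ∧ e.target = I ×ˢ W ∧
          -- in which the position vector is `φ(s, t) = (αhat(s) γ(t), s)`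
          ContDiffOn ℝ ∞ αhat I ∧ (∀ s ∈ I, αhat s ≠ 0) ∧
          (∀ s ∈ I, ∀ t ∈ W, φ (e.symm (s, t)) = pairLast (αhat s • γ t) s) ∧
          -- `γ` parametrizes a space-like totally umbilical submanifold in `Σ(a, τ)`
          a ≠ 0 ∧ mink a a = c ∧ (c = 1 ∨ c = -1 ∨ c = 0) ∧ 0 < τ ∧
          IsSpacelikeOn γ W ∧ (∀ t ∈ W, γ t ∈ sigmaSet a τ) ∧
          IsTotallyUmbilicalOn γ W ∧
          -- and `αhat` solves the differential equation
          ∀ s ∈ I, ((n : ℝ) - 2) * τ ^ 2 * αhat s * deriv (deriv αhat) s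
            - ((n : ℝ) - 1) * (c + τ ^ 2 * (deriv αhat s) ^ 2) = 0 := by
  refine ⟨fun h p => h.exists_warped_coordinates hn hφ hLC p, fun h => ?_⟩
  refine isPseudoUmbilical_of_local (by omega) hφ fun p => ?_
  obtain ⟨I, W, αhat, γ, a, c, τ, e, hI, -, hW, hp, ht, hα, hα0, hw, -, rfl, -, hτ, hγ, hγa, -,
    hode⟩ := h p
  -- The factor of `UmbilicalFrame.shapeForm_eq` with `b = α̂'' / (α̂ (2n - 2))`, a smooth function
  -- of the coordinate `s` alone.
  refine ⟨fun q => -(((n : ℝ) - 1) * (2 * n - 2) *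
    (deriv (deriv αhat) (e q).1 / (αhat (e q).1 * (2 * n - 2))) / n), ?_, ?_⟩
  · have hs : (e p).1 ∈ I := (ht ▸ e.map_source hp : e p ∈ I ×ˢ W).1
    have h1 : ContDiffAt ℝ ∞ αhat (e p).1 := hα.contDiffAt (hI.mem_nhds hs)
    have h2 : ContDiffAt ℝ ∞ (deriv (deriv αhat)) (e p).1 :=
      (h1.derivWithin (m := ∞) (by simp)).derivWithin (by simp)
    have hn2 : (2 : ℝ) < n := by exact_mod_cast hn
    let g : ℝ → ℝ := fun s => -(((n : ℝ) - 1) * (2 * n - 2) *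
      (deriv (deriv αhat) s / (αhat s * (2 * n - 2))) / n)
    have h3 : ContDiffAt ℝ ∞ g (e p).1 :=
      ((contDiffAt_const.mul (h2.div (h1.mul contDiffAt_const)
        (mul_ne_zero (hα0 _ hs) (by linarith)))).div_const _).neg
    have h4 : ContMDiffAt (𝓡 n) 𝓘(ℝ, ℝ) ∞ (fun q => (e q).1) p :=
      (contDiff_fst.contMDiff.contMDiffAt).comp p
        (e.contMDiffOn_toFun.contMDiffAt (e.open_source.mem_nhds hp))
    exact ContMDiffAt.comp (g := g) p h3.contMDiffAt h4
  · filter_upwards [e.open_source.mem_nhds hp] with q hq X Y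
    obtain ⟨ξ, hξ⟩ := exists_umbilicalFrame_of_warped hn hφ e hI hW ht hα hα0 hw hτ hγ.smooth hγa
      hode hq
    exact hξ.shapeForm_eq hn ((contDiffAt_inChart hφ.smooth q).of_le two_le_infty)
      (Filter.Eventually.of_forall fun x => hLC _) (hφ.nondegenerate q) X Y
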